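/- Fix a nonnegative radial $\chi\in C_0^\infty(\mathbb R^3)$ with $\chi(\xi)=1$ for $|\xi|\le 3/4$ and $\chi(\xi)=0$ for $|\xi|\ge 1$. Put $\lambda_q=2^q$, $\varphi(\xi)=\chi(\xi/2)-\chi(\xi)$, $u_q=\Delta_q u=\mathcal F^{-1}(\varphi(\lambda_q^{-1}\xi)\mathcal Fu)$ for $q\ge 0$, $u_{-1}=\Delta_{-1}u=\mathcal F^{-1}(\chi\,\mathcal Fu)$, $u_{\le Q}=\sum_{q=-1}^{Q}u_q$, $\|u\|_{B^{\sigma}_{r,\infty}}=\sup_{q\ge -1}\lambda_q^{\sigma}\|u_q\|_{L^r}$, and $\|\cdot\|_r=\|\cdot\|_{L^r(\mathbb R^3)}$. Let $\nu,\mu,T>0$ and consider on $\mathbb R^3$ the MHD equations $$u_t+u\cdot\nabla u-b\cdot\nabla b+\nabla p=\nu\Delta u,\qquad b_t+u\cdot\nabla b-b\cdot\nabla u=\mu\Delta b,\qquad \nabla\cdot u=\nabla\cdot b=0 .$$ A weak solution on $[0,T]$ is a pair of divergence free $u,b\in C_w([0,T];L^2)\cap L^2(0,T;H^1)$ which satisfies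 the equations in the integrated weak form against all divergence free test functions $\phi\in C_0^\infty([0,T]\times\mathbb R^3)$. It is regular on a time interval $I$ if, for some $s>1/2$, $\|u(t)\|_{H^s}$ and $\|b(t)\|_{H^s}$ are finite and continuous on $I$. **Theorem.** For every $r\in[2,\infty]$ there is a constant $\kappa_r>0$, depending only on $r$ (and on $\chi$), with the following property. Let $c>0$, let $(u,b)$ be a weak solution on $[0,T]$ that is regular on $(0,T)$, and suppose that $r<6$ or that $b\equiv 0$ on $[0,T]$. For $t\in[0,T]$ let $Q(t)\in\mathbb N\cup\{\infty\}$ be the least $q\in\mathbb N$ such that $\lambda_p^{-1+3/r}\|u_p(t)\|_r<c\min\{\nu,\mu\}$ for all $p>q$ (with $Q(t)=\infty$ if there is none), and let $$\mathcal T_q=\sup\{t\in(T/2,T): Q(\tau)<q\ \text{ for all }\tau\in(T/2,t)\}.$$ Then $\mathcal T_q\to T$ as $q\to\infty$, and $$\limsup_{q\to\infty}\int_{T/2}^T 1_{q\le Q(\tau)}\,\lambda_q\|u_q(\tau)\|_\infty\,d\tau\le c$$ holds provided that, with $c'=\kappa_r c$, one of the following conditions is satisfied: 1. $\limsup_{q\to\infty}\int_{\mathcal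 T_q}^T\|\Delta_q(\nabla\times u)\|_\infty\,dt\le c'$; 2. $\lim_{\epsilon\to0+}\limsup_{q\to\infty}\int_{T-\epsilon}^T\|\Delta_q(\nabla\times u)\|_\infty\,dt\le c'$; 3. $\int_0^T\sup_{-1\le q\le Q(t)}\|\Delta_q(\nabla\times u)\|_\infty\,dt<\infty$; 4. $\limsup_{q\to\infty}\int_0^T1_{q\le Q(t)}\big(\lambda_q^{-1+\frac2l+\frac3r}\|u_q(t)\|_r\big)^l\,dt\le (c')^l\min\{\nu,\mu\}^{l-1}$ for some $1\le l<\infty$; 5. $\limsup_{q\to\infty}\int_{\mathcal T_q}^T\big(\lambda_q^{-1+\frac2l+\frac3r}\|u_q(t)\|_r\big)^l\,dt\le (c')^l\min\{\nu,\mu\}^{l-1}$ for some $1\le l<\infty$; 6. $\lim_{\epsilon\to0+}\limsup_{q\to\infty}\int_{T-\epsilon}^T\big(\lambda_q^{-1+\frac2l+\frac3r}\|u_q(t)\|_r\big)^l\,dt\le (c')^l\min\{\nu,\mu\}^{l-1}$ for some $1\le l<\infty$; 7. $\int_0^T\|u_{\le Q(t)}(t)\|_{B^{-1+\frac2l+\frac3r}_{r,\infty}}^l\,dt<\infty$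 for some $1\le l<\infty$; 8. $\limsup_{t\to T-}\|u(t)-u(T)\|_{B^{-1+\frac3r}_{r,\infty}}\le \frac{c'\min\{\nu,\mu\}}{2}$. -/

import Mathlib

open MeasureTheory Set Filter Topology FourierTransform
open scoped ENNReal ContDiff Laplacian Gradient

noncomputable section

namespace MHD

/-- Physical space `ℝ³` with the Euclidean norm. -/
abbrev E3 : Type := EuclideanSpace ℝ (Fin 3)

/-- Square integrable vector fields `L²(ℝ³; ℝ³)`. -/
abbrev L2 : Type := Lp E3 2 (volume : Measure E3)

/-! ### Littlewood-Paley decomposition -/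

/-- A nonnegative radial smooth function, equal to `1` for `|ξ| ≤ 3/4` and to `0` for `|ξ| ≥ 1`. -/
structure IsCutoff (χ : E3 → ℝ) : Prop where
  smooth : ContDiff ℝ ∞ χ
  nonneg : ∀ ξ, 0 ≤ χ ξ
  radial : ∀ ξ η, ‖ξ‖ = ‖η‖ → χ ξ = χ η
  eq_one : ∀ ξ, ‖ξ‖ ≤ 3 / 4 → χ ξ = 1
  eq_zero : ∀ ξ, 1 ≤ ‖ξ‖ → χ ξ = 0

/-- The dyadic numbers `λ_q = 2^q`. -/
def lam (q : ℤ) : ℝ := (2 : ℝ) ^ q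

/-- `φ(ξ) = χ(ξ/2) - χ(ξ)`. -/
def annulus (χ : E3 → ℝ) (ξ : E3) : ℝ := χ ((2 : ℝ)⁻¹ • ξ) - χ ξ

/-- The dyadic partition of unity: `φ_q(ξ) = φ(λ_q⁻¹ ξ)` for `q ≥ 0` and `φ_{-1} = χ`.
The indices `q < -1` do not occur in the decomposition. -/
def symbol (χ : E3 → ℝ) (q : ℤ) (ξ : E3) : ℝ :=
  if 0 ≤ q then annulus χ ((lam q)⁻¹ • ξ) else if q = -1 then χ ξ else 0

/-- The convolution kernel `𝓕⁻¹ φ_q`. It is real valued, since `φ_q` is real and even. -/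
def kernel (χ : E3 → ℝ) (q : ℤ) (y : E3) : ℝ :=
  (𝓕⁻ (fun ξ : E3 => (symbol χ q ξ : ℂ)) y).re

/-- The Littlewood-Paley block `Δ_q v (x) = ∫ (𝓕⁻¹ φ_q)(y) v(x - y) dy`. -/
def block (χ : E3 → ℝ) (q : ℤ) (v : E3 → E3) (x : E3) : E3 :=
  ∫ y, kernel χ q y • v (x - y)

/-- The cross product on `ℝ³`. -/
def cross (a b : E3) : E3 := WithLp.toLp 2 (crossProduct a.ofLp b.ofLp)

/-- The distribution `∇ × v` applied to the scalar test function `ψ`: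
`⟨∇ × v, ψ⟩ = ∫ v × ∇ψ`. -/
def distribCurl (v : E3 → E3) (ψ : E3 → ℝ) : E3 := ∫ y, cross (v y) (∇ ψ y)

/-- The block `Δ_q (∇ × v)` of the distribution `∇ × v`, that is, its convolution with
`𝓕⁻¹ φ_q`. -/
def blockCurl (χ : E3 → ℝ) (q : ℤ) (v : E3 → E3) (x : E3) : E3 :=
  distribCurl v (fun y => kernel χ q (x - y))

/-- `3 / r`, equal to `0` for `r = ∞`. -/
def threeDiv (r : ℝ≥0∞) : ℝ := 3 * (r⁻¹).toReal

/-- `λ_q^σ ‖Δ_q v‖_{L^r}`. -/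
def weightedBlock (χ : E3 → ℝ) (σ : ℝ) (r : ℝ≥0∞) (q : ℤ) (v : E3 → E3) : ℝ≥0∞ :=
  ENNReal.ofReal (lam q ^ σ) * eLpNorm (block χ q v) r volume

/-- The norm of the Besov space `B^σ_{r,∞}`: `sup_{q ≥ -1} λ_q^σ ‖Δ_q v‖_{L^r}`. -/
def besovNorm (χ : E3 → ℝ) (σ : ℝ) (r : ℝ≥0∞) (v : E3 → E3) : ℝ≥0∞ :=
  ⨆ (q : ℤ) (_ : -1 ≤ q), weightedBlock χ σ r q v

/-- The low modes `v_{≤ Q} = ∑_{q = -1}^{Q} Δ_q v`; this is `v` if `Q = ∞`. -/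
def lowModes (χ : E3 → ℝ) (Q : ℕ∞) (v : E3 → E3) : E3 → E3 :=
  if Q = ⊤ then v else fun x => ∑ q ∈ Finset.Icc (-1 : ℤ) (Q.toNat : ℤ), block χ q v x

/-! ### Sobolev norms -/

/-- The inclusion `ℝ³ → ℂ³`. -/
def complexify : E3 →L[ℝ] EuclideanSpace ℂ (Fin 3) :=
  LinearMap.toContinuousLinearMap
    { toFun := fun v => WithLp.toLp 2 (fun i => (v i : ℂ))
      map_add' := by intro v w; ext i; simp
      map_smul' := by intro a v; ext i; simp }

/-- The Fourier transform of an `L²` vector field. -/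
def fourierL2 (v : L2) : Lp (EuclideanSpace ℂ (Fin 3)) 2 (volume : Measure E3) :=
  𝓕 (complexify.compLp v)

/-- The norm of `H^s(ℝ³)` (with value `∞` outside of `H^s`):
`‖v‖_{H^s}² = ∫ (1 + |ξ|²)^s |v̂(ξ)|² dξ`. -/
def sobolevNorm (s : ℝ) (v : L2) : ℝ≥0∞ :=
  (∫⁻ ξ, ENNReal.ofReal ((1 + ‖ξ‖ ^ 2) ^ s) * ‖fourierL2 v ξ‖ₑ ^ (2 : ℝ)) ^ (1 / 2 : ℝ)

/-! ### Weak and regular solutions -/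

/-- `∇ · v = 0` in the sense of distributions. -/
def IsDivFree (v : L2) : Prop :=
  ∀ ψ : E3 → ℝ, ContDiff ℝ ∞ ψ → HasCompactSupport ψ → ∫ x, inner ℝ (v x) (∇ ψ x) = 0

/-- Test functions in `C₀^∞([0,T] × ℝ³; ℝ³)` which are divergence free in space. They are
written as restrictions of smooth compactly supported functions on `ℝ × ℝ³`. -/
structure IsTestField (T : ℝ) (φ : ℝ → E3 → E3) : Prop where
  smooth : ContDiff ℝ ∞ (fun p : ℝ × E3 => φ p.1 p.2)
  compact : HasCompactSupport (fun p : ℝ × E3 => φ p.1 p.2)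
  divFree : ∀ t ∈ Icc 0 T, ∀ x,
    ∑ i : Fin 3, fderiv ℝ (φ t) x (EuclideanSpace.single i 1) i = 0

/-- Membership in `C_w([0,T]; L²) ∩ L²(0,T; H¹)`, with divergence free values. -/
structure InEnergyClass (T : ℝ) (u : ℝ → L2) : Prop where
  weaklyContinuous : ∀ w : L2, ContinuousOn (fun t => inner ℝ (u t) w) (Icc 0 T)
  sobolev : ∫⁻ t in Icc 0 T, sobolevNorm 1 (u t) ^ (2 : ℝ) < ⊤
  divFree : ∀ t ∈ Icc 0 T, IsDivFree (u t)

/-- `(u, b)` is a weak solution on `[0,T]` of the MHD equations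
`u_t + u·∇u - b·∇b + ∇p = νΔu`, `b_t + u·∇b - b·∇u = μΔb`, `∇·u = ∇·b = 0` on `ℝ³`,
with initial data `(u 0, b 0)`. Here `v·∇φ` is `fderiv ℝ φ x (v x)`. -/
structure IsWeakSolution (ν μ T : ℝ) (u b : ℝ → L2) : Prop where
  velocity : InEnergyClass T u
  magnetic : InEnergyClass T b
  velocity_eq : ∀ φ : ℝ → E3 → E3, IsTestField T φ → ∀ t ∈ Icc 0 T,
    (∫ x, inner ℝ (u t x) (φ t x)) - ∫ x, inner ℝ (u 0 x) (φ 0 x) =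
      ∫ s in (0 : ℝ)..t,
        ((∫ x, inner ℝ (u s x) (deriv (fun τ => φ τ x) s))
          + ν * (∫ x, inner ℝ (u s x) (Δ (φ s) x))
          + (∫ x, inner ℝ (fderiv ℝ (φ s) x (u s x)) (u s x))
          - ∫ x, inner ℝ (fderiv ℝ (φ s) x (b s x)) (b s x))
  magnetic_eq : ∀ φ : ℝ → E3 → E3, IsTestField T φ → ∀ t ∈ Icc 0 T,
    (∫ x, inner ℝ (b t x) (φ t x)) - ∫ x, inner ℝ (b 0 x) (φ 0 x) =
      ∫ s in (0 : ℝ)..t,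
        ((∫ x, inner ℝ (b s x) (deriv (fun τ => φ τ x) s))
          + μ * (∫ x, inner ℝ (b s x) (Δ (φ s) x))
          + (∫ x, inner ℝ (fderiv ℝ (φ s) x (u s x)) (b s x))
          - ∫ x, inner ℝ (fderiv ℝ (φ s) x (b s x)) (u s x))

/-- `(u, b)` is regular on the time interval `I`: for some `s > 1/2` the norms `‖u(t)‖_{H^s}` and
`‖b(t)‖_{H^s}` are (finite and) continuous on `I`. -/
def IsRegularOn (u b : ℝ → L2) (I : Set ℝ) : Prop :=
  ∃ s : ℝ, 1 / 2 < s ∧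
    (∀ t ∈ I, sobolevNorm s (u t) < ⊤ ∧ sobolevNorm s (b t) < ⊤) ∧
    ContinuousOn (fun t => sobolevNorm s (u t)) I ∧
    ContinuousOn (fun t => sobolevNorm s (b t)) I

/-! ### The dissipation wavenumber -/

/-- The index `Q` of the dissipation wavenumber `Λ = λ_Q` of the velocity field `v`: the least
`q ∈ ℕ` with `λ_p^{-1+3/r} ‖Δ_p v‖_r < m` for all `p > q` (with `m = c min{ν, μ}`), and `∞` if
there is none. -/
def dissIndex (χ : E3 → ℝ) (r : ℝ≥0∞) (m : ℝ) (v : E3 → E3) : ℕ∞ :=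
  sInf ((fun q : ℕ => (q : ℕ∞)) '' {q : ℕ | ∀ p : ℕ, q < p →
    weightedBlock χ (-1 + threeDiv r) r p v < ENNReal.ofReal m})

/-- `𝒯_q = sup {t ∈ (T/2, T) : Q(τ) < q for all τ ∈ (T/2, t)}`. -/
def Tq (T : ℝ) (Q : ℝ → ℕ∞) (q : ℕ) : ℝ :=
  sSup {t | t ∈ Ioo (T / 2) T ∧ ∀ τ ∈ Ioo (T / 2) t, Q τ < (q : ℕ∞)}

/-- The regularity criterion
`limsup_{q → ∞} ∫_{T/2}^T 1_{q ≤ Q(τ)} λ_q ‖Δ_q u(τ)‖_∞ dτ ≤ c`. -/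
def Criterion (χ : E3 → ℝ) (c T : ℝ) (Q : ℝ → ℕ∞) (u : ℝ → L2) : Prop :=
  limsup (fun q : ℕ => ∫⁻ τ in Icc (T / 2) T,
    {τ | (q : ℕ∞) ≤ Q τ}.indicator (fun τ => weightedBlock χ 1 ⊤ q (u τ)) τ) atTop
    ≤ ENNReal.ofReal c

end MHD

end

noncomputable section

namespace MHD

open scoped SchwartzMap LineDeriv

/-! ### Convolution multipliers with Schwartz symbols -/

section Multiplier

variable {F : Type*} [NormedAddCommGroup F]

/-! Write `m = min ν μ`, `F_p(t) = λ_p^{-1+3/r}‖u_p(t)‖_r` and `M = c m`. For `q ≥ 1`, `q ≤ Q(t)`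
holds exactly when `F_p(t) ≥ M` for some `p ≥ q`. Interpolating Bernstein's inequality with the `L²`
decay of blocks gives `F_p ≤ C λ_p^{1/2-s}‖u‖_{H^s}`. Since `s > 1/2`, regularity bounds `Q` on
compact subintervals of `(0,T)`, whence `𝒯_q → T`. For almost every `t` in `[T/2,T]`, `q ≤ Q(t)`
forces `t ≥ 𝒯_q`, so integrals over `{q ≤ Q}` are bounded by integrals over `[𝒯_q,T]`, and these
tend to zero when the integrand is a fixed integrable function.

Vorticity conditions: a localized Biot-Savart law (`exists_biotSavart`) gives `λ_q‖u_q‖_∞ ≤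
C‖Δ_q(∇×u)‖_∞` for divergence free `u` and `q ≥ 0`.

Besov conditions: all of them reduce to the one with `1_{q≤Q}`, taken over `[T/2,T]`. Bernstein
gives `λ_q‖u_q‖_∞ ≤ C λ_q² F_q`, and the hypothesis bounds `∫ 1_{q≤Q} λ_q² F_q^l`. To go from the
power `l` to the power one, use `F_q ≤ M + M^{1-l}F_q^l`. What remains is `λ_q² M |{q ≤ Q}|`. By
Chebyshev `|{F_p ≥ M}| ≤ δ M^{-l}λ_p^{-2}`, and summing over `p ≥ q` is a geometric series of ratio
`1/4`. This is `lintegral_le_of_threshold`; the powers of `c` and `m` then cancel so that `κ` does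
not depend on `l`.

Small jump: comparing `u(t)` with `u(t₁)` through `u(T)`, for a fixed `t₁` close to `T`, makes every
high block of `u(t)` fall below the threshold. Then `Q` is bounded on `[T/2,T)` and the criterion
integrals vanish for large `q`. -/

theorem eLpNorm_comp_sub_left {g : E3 → F} (hg : AEStronglyMeasurable g volume) (x : E3)
    (p : ℝ≥0∞) : eLpNorm (fun y => g (x - y)) p volume = eLpNorm g p volume :=
  eLpNorm_comp_measurePreserving hg (Measure.measurePreserving_sub_left volume x)

theorem aestronglyMeasurable_comp_sub_left {g : E3 → F} (hg : AEStronglyMeasurable g volume)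
    (x : E3) : AEStronglyMeasurable (fun y => g (x - y)) volume :=
  hg.comp_measurePreserving (Measure.measurePreserving_sub_left volume x)

variable [NormedSpace ℂ F]

/-- The convolution kernel of the Fourier multiplier with symbol `a`. -/
abbrev ckernel (a : 𝓢(E3, ℂ)) : 𝓢(E3, ℂ) := 𝓕⁻ a

/-- The Fourier multiplier with Schwartz symbol `a`, written as a convolution. -/
def mult (a : 𝓢(E3, ℂ)) (g : E3 → F) (x : E3) : F := ∫ y, (𝓕⁻ a) y • g (x - y)

/-- Hölder's inequality for convolutions. -/
theorem lintegral_mult_le (K : 𝓢(E3, ℂ)) {g : E3 → F} (hg : AEStronglyMeasurable g volume)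
    (p r : ℝ≥0∞) [ENNReal.HolderConjugate p r] (x : E3) :
    ∫⁻ y, ‖K y • g (x - y)‖ₑ ≤ eLpNorm K p volume * eLpNorm g r volume := by
  have h := eLpNorm_le_eLpNorm_mul_eLpNorm_of_nnnorm (p := p) (q := r) (r := 1)
    (K.continuous.aestronglyMeasurable (μ := volume)) (aestronglyMeasurable_comp_sub_left hg x)
    (fun a b => a • b) 1 (ae_of_all _ fun y => by simp [nnnorm_smul])
  rw [eLpNorm_one_eq_lintegral_enorm, eLpNorm_comp_sub_left hg] at h
  simpa using h

theorem enorm_mult_le (a : 𝓢(E3, ℂ)) {g : E3 → F} (hg : AEStronglyMeasurable g volume)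
    (p r : ℝ≥0∞) [ENNReal.HolderConjugate p r] (x : E3) :
    ‖mult a g x‖ₑ ≤ eLpNorm (ckernel a) p volume * eLpNorm g r volume :=
  (enorm_integral_le_lintegral_enorm _).trans (lintegral_mult_le _ hg p r x)

theorem integrable_mult (K : 𝓢(E3, ℂ)) {r : ℝ≥0∞} (hr : 1 ≤ r) {g : E3 → F} (hg : MemLp g r volume)
    (x : E3) : Integrable (fun y => K y • g (x - y)) volume := by
  refine ⟨K.continuous.aestronglyMeasurable.smul (aestronglyMeasurable_comp_sub_left hg.1 x), ?_⟩
  have : ENNReal.HolderConjugate (ENNReal.conjExponent r) r :=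
    (ENNReal.HolderConjugate.conjExponent hr).symm
  exact (lintegral_mult_le K hg.1 (ENNReal.conjExponent r) r x).trans_lt
    (ENNReal.mul_lt_top (K.eLpNorm_lt_top _ _) hg.2)

theorem mult_sub_right (a : 𝓢(E3, ℂ)) {r : ℝ≥0∞} (hr : 1 ≤ r) {g h : E3 → F}
    (hg : MemLp g r volume) (hh : MemLp h r volume) (x : E3) :
    mult a (fun y => g y - h y) x = mult a g x - mult a h x := by
  simp only [mult, smul_sub]
  exact integral_sub (integrable_mult _ hr hg x) (integrable_mult _ hr hh x)

theorem mult_congr_ae (a : 𝓢(E3, ℂ)) {g h : E3 → F} (hgh : g =ᵐ[volume] h) (x : E3) :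
    mult a g x = mult a h x := by
  refine integral_congr_ae ?_
  filter_upwards [(Measure.measurePreserving_sub_left volume x).quasiMeasurePreserving.ae_eq_comp
    hgh] with y hy
  simp only [Function.comp_apply] at hy
  rw [hy]

theorem mult_add_left (a b : 𝓢(E3, ℂ)) {r : ℝ≥0∞} (hr : 1 ≤ r) {g : E3 → F}
    (hg : MemLp g r volume) (x : E3) : mult (a + b) g x = mult a g x + mult b g x := by
  simp only [mult, FourierTransform.fourierInv_add, add_apply, add_smul]
  exact integral_add (integrable_mult _ hr hg x) (integrable_mult _ hr hg x)

theorem mult_zero_left (g : E3 → F) (x : E3) : mult 0 g x = 0 := by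
  have : 𝓕⁻ (0 : 𝓢(E3, ℂ)) = 0 := map_zero (FourierTransform.fourierInvCLM ℂ 𝓢(E3, ℂ))
  simp [mult, this]

theorem mult_sum_left {ι : Type*} (s : Finset ι) (a : ι → 𝓢(E3, ℂ)) {r : ℝ≥0∞} (hr : 1 ≤ r)
    {g : E3 → F} (hg : MemLp g r volume) (x : E3) :
    mult (∑ i ∈ s, a i) g x = ∑ i ∈ s, mult (a i) g x := by
  classical
  induction s using Finset.induction_on with
  | empty => simp [mult_zero_left]
  | insert i s hi ih => rw [Finset.sum_insert hi, Finset.sum_insert hi, mult_add_left _ _ hr hg, ih]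

/-- The pointwise product of a scalar and a vector valued Schwartz function. -/
abbrev smulS (a : 𝓢(E3, ℂ)) (f : 𝓢(E3, F)) : 𝓢(E3, F) :=
  SchwartzMap.pairing (ContinuousLinearMap.lsmul ℂ ℂ) a f

theorem exists_schwartz_approx {g : E3 → F} (hg : MemLp g 2 volume) :
    ∃ f : ℕ → 𝓢(E3, F), Tendsto (fun n => eLpNorm (fun x => f n x - g x) 2 volume) atTop (𝓝 0) := by
  have hd := SchwartzMap.denseRange_toLpCLM (F := F) (E := E3) (p := 2) (by simp) (μ := volume)
  obtain ⟨w, hw, hlim⟩ := mem_closure_iff_seq_limit.1 (hd (hg.toLp g))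
  choose f hf using hw
  refine ⟨f, ?_⟩
  rw [tendsto_iff_edist_tendsto_0] at hlim
  refine hlim.congr fun n => ?_
  rw [← hf n, Lp.edist_def]
  refine eLpNorm_congr_ae ?_
  filter_upwards [hg.coeFn_toLp, (f n).coeFn_toLp 2 volume] with x h1 h2
  simp [h1, h2]

theorem enorm_mult_sub_le (a : 𝓢(E3, ℂ)) {g h : E3 → F} (hg : MemLp g 2 volume)
    (hh : MemLp h 2 volume) (x : E3) :
    ‖mult a g x - mult a h x‖ₑ ≤ eLpNorm (ckernel a) 2 volume * eLpNorm (fun y => g y - h y) 2 volume := by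
  rw [← mult_sub_right a one_le_two hg hh]
  exact enorm_mult_le a (hg.sub hh).1 2 2 x

/-- Hölder with exponents `2, 2` turns `L²` convergence of the data into uniform convergence of the
filtered fields. Continuity, composition and the Plancherel bound can thus be checked on Schwartz
data and passed to the limit at every point. -/
theorem tendsto_mult (a : 𝓢(E3, ℂ)) {g : E3 → F} (hg : MemLp g 2 volume) {f : ℕ → 𝓢(E3, F)}
    (hf : Tendsto (fun n => eLpNorm (fun x => f n x - g x) 2 volume) atTop (𝓝 0)) :
    TendstoUniformly (fun n => mult a (f n)) (mult a g) atTop := by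
  have h0 : Tendsto (fun n => eLpNorm (ckernel a) 2 volume * eLpNorm (fun x => f n x - g x) 2 volume)
      atTop (𝓝 0) := by
    simpa using ENNReal.Tendsto.const_mul hf (Or.inr ((ckernel a).eLpNorm_lt_top 2 volume).ne)
  rw [EMetric.tendstoUniformly_iff]
  intro ε hε
  filter_upwards [h0.eventually (gt_mem_nhds hε)] with n hn x
  rw [edist_comm, edist_eq_enorm_sub]
  exact (enorm_mult_sub_le a ((f n).memLp 2 volume) hg x).trans_lt hn

variable [CompleteSpace F]

theorem mult_schwartz (a : 𝓢(E3, ℂ)) (f : 𝓢(E3, F)) (x : E3) :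
    mult a f x = (𝓕⁻ (smulS a (𝓕 f))) x := by
  have h := SchwartzMap.convolution_apply (ContinuousLinearMap.lsmul ℂ ℂ) (𝓕⁻ a) f x
  have h2 := SchwartzMap.fourier_convolution (ContinuousLinearMap.lsmul ℂ ℂ) (𝓕⁻ a) f
  rw [FourierTransform.fourier_fourierInv_eq] at h2
  rw [smulS, ← h2, FourierTransform.fourierInv_fourier_eq, h]
  rfl

theorem continuous_mult (a : 𝓢(E3, ℂ)) {g : E3 → F} (hg : MemLp g 2 volume) :
    Continuous (mult a g) := by
  obtain ⟨f, hf⟩ := exists_schwartz_approx hg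
  refine (tendsto_mult a hg hf).continuous (Eventually.frequently (Eventually.of_forall fun n => ?_))
  rw [show mult a (f n) = 𝓕⁻ (smulS a (𝓕 (f n))) from funext (mult_schwartz a (f n))]
  exact SchwartzMap.continuous _

theorem memLp_top_mult (a : 𝓢(E3, ℂ)) {g : E3 → F} (hg : MemLp g 2 volume) :
    MemLp (mult a g) ⊤ volume :=
  ⟨(continuous_mult a hg).aestronglyMeasurable, (eLpNormEssSup_le_of_ae_enorm_bound
    (ae_of_all _ fun x => enorm_mult_le a hg.1 2 2 x)).trans_lt
    (ENNReal.mul_lt_top ((ckernel a).eLpNorm_lt_top _ _) hg.2)⟩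

/-- For Schwartz data both sides are `𝓕⁻ (a b 𝓕 f)`. In the limit the inner multiplier converges in
`L^∞`, and the outer one is continuous there because its kernel is in `L¹`. -/
theorem mult_mult (a b : 𝓢(E3, ℂ)) {g : E3 → F} (hg : MemLp g 2 volume) (x : E3) :
    mult a (mult b g) x = mult (smulS a b) g x := by
  obtain ⟨f, hf⟩ := exists_schwartz_approx hg
  have hb := tendsto_mult b hg hf
  have hab := (tendsto_mult (smulS a b) hg hf).tendsto_at x
  have hs : ∀ n, mult b (f n) = 𝓕⁻ (smulS b (𝓕 (f n))) := fun n => funext (mult_schwartz b (f n))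
  have hbd := memLp_top_mult b hg
  refine tendsto_nhds_unique (f := fun n => mult a (mult b (f n)) x) ?_ (hab.congr fun n => ?_)
  · rw [tendsto_iff_edist_tendsto_0]
    have hsup : Tendsto (fun n => eLpNorm (fun x => mult b (f n) x - mult b g x) ⊤ volume)
        atTop (𝓝 0) := by
      have h0 : Tendsto (fun n => eLpNorm (ckernel b) 2 volume *
          eLpNorm (fun x => f n x - g x) 2 volume) atTop (𝓝 0) := by
        simpa using ENNReal.Tendsto.const_mul hf (Or.inr ((ckernel b).eLpNorm_lt_top 2 volume).ne)
      refine tendsto_of_tendsto_of_tendsto_of_le_of_le tendsto_const_nhds h0 (fun _ => zero_le)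
        fun n => ?_
      rw [eLpNorm_exponent_top]
      exact eLpNormEssSup_le_of_ae_enorm_bound
        (ae_of_all _ fun x => enorm_mult_sub_le b ((f n).memLp 2 volume) hg x)
    have h1 : Tendsto (fun n => eLpNorm (ckernel a) 1 volume *
          eLpNorm (fun x => mult b (f n) x - mult b g x) ⊤ volume) atTop (𝓝 0) := by
      simpa using ENNReal.Tendsto.const_mul hsup (Or.inr ((ckernel a).eLpNorm_lt_top 1 volume).ne)
    refine tendsto_of_tendsto_of_tendsto_of_le_of_le tendsto_const_nhds h1 (fun _ => zero_le)
        fun n => ?_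
    have hm : MemLp (mult b (f n)) ⊤ volume := by rw [hs]; exact SchwartzMap.memLp_top _ _
    simp only [edist_eq_enorm_sub]
    rw [← mult_sub_right a le_top hm hbd]
    exact enorm_mult_le a (hm.sub hbd).1 1 ⊤ x
  · rw [hs, mult_schwartz, mult_schwartz]
    congr 2
    rw [FourierTransform.fourier_fourierInv_eq]
    ext y
    simp only [smulS, SchwartzMap.pairing_apply_apply, ContinuousLinearMap.lsmul_apply, smul_eq_mul,
      mul_smul]

end Multiplier

/-! ### The Plancherel bound for multipliers -/

section Plancherel

variable {F : Type*} [NormedAddCommGroup F] [InnerProductSpace ℂ F] [CompleteSpace F]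

theorem eLpNorm_fourierInv_schwartz (f : 𝓢(E3, F)) :
    eLpNorm (𝓕⁻ f : 𝓢(E3, F)) 2 volume = eLpNorm f 2 volume := by
  have h := SchwartzMap.norm_fourier_toL2_eq (𝓕⁻ f)
  rw [FourierTransform.fourier_fourierInv_eq, SchwartzMap.norm_toLp, SchwartzMap.norm_toLp] at h
  exact ((ENNReal.toReal_eq_toReal_iff' (SchwartzMap.eLpNorm_lt_top _ _ _).ne
    (SchwartzMap.eLpNorm_lt_top _ _ _).ne).1 h).symm

theorem tendsto_eLpNorm_fourier_sub {g : Lp F 2 (volume : Measure E3)} {f : ℕ → 𝓢(E3, F)}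
    (hf : Tendsto (fun n => eLpNorm (fun x => f n x - g x) 2 volume) atTop (𝓝 0)) :
    Tendsto (fun n => eLpNorm (fun x => (𝓕 (f n)) x -
      (𝓕 g : Lp F 2 (volume : Measure E3)) x) 2 volume) atTop (𝓝 0) := by
  refine hf.congr fun n => ?_
  have h2 : edist ((f n).toLp 2 volume) g = edist (𝓕 ((f n).toLp 2 volume)) (𝓕 g) := by
    rw [edist_dist, edist_dist, dist_eq_norm, dist_eq_norm, ← Lp.norm_fourier_eq,
      show 𝓕 ((f n).toLp 2 volume - g) = 𝓕 ((f n).toLp 2 volume) - 𝓕 g from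
        map_sub (FourierTransform.fourierCLM ℂ (Lp F 2 (volume : Measure E3))) _ _]
  rw [SchwartzMap.toLp_fourier_eq, Lp.edist_def, Lp.edist_def] at h2
  refine (eLpNorm_congr_ae ?_).trans (h2.trans (eLpNorm_congr_ae ?_))
  · filter_upwards [(f n).coeFn_toLp 2 volume] with x h3
    simp [h3]
  · filter_upwards [(𝓕 (f n)).coeFn_toLp 2 volume] with x h3
    simp [h3]

/-- `G` stands for the transform of the `L²` field approximated by `f`; the splitting `𝓕 f = (𝓕 f -
G) + G` isolates an error that vanishes in the limit. -/
theorem eLpNorm_mult_schwartz_le (a : 𝓢(E3, ℂ)) (f : 𝓢(E3, F)) {G : E3 → F}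
    (hG : AEStronglyMeasurable G volume) : eLpNorm (mult a f) 2 volume ≤
      eLpNorm a ⊤ volume * eLpNorm (fun x => (𝓕 f) x - G x) 2 volume +
        eLpNorm (fun ξ => a ξ • G ξ) 2 volume := by
  rw [show mult a f = (𝓕⁻ (smulS a (𝓕 f)) : 𝓢(E3, F)) from funext (mult_schwartz a f),
    eLpNorm_fourierInv_schwartz]
  have hd : AEStronglyMeasurable (fun x => (𝓕 f) x - G x) volume :=
    (SchwartzMap.continuous _).aestronglyMeasurable.sub hG
  have ha : AEStronglyMeasurable a volume := a.continuous.aestronglyMeasurable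
  have hsum : (⇑(smulS a (𝓕 f))) = (fun x => a x • ((𝓕 f) x - G x)) + fun ξ => a ξ • G ξ := by
    ext x; simp [smulS, smul_sub]
  have h := eLpNorm_le_eLpNorm_mul_eLpNorm_of_nnnorm (p := ⊤) (q := 2) (r := 2) ha hd
    (fun a b => a • b) 1 (ae_of_all _ fun y => by simp [nnnorm_smul])
  rw [ENNReal.coe_one, one_mul] at h
  rw [hsum]
  exact (eLpNorm_add_le (ha.smul hd) (ha.smul hG) one_le_two).trans (add_le_add h le_rfl)

/-- Only an upper bound is needed, so Fatou's lemma along the Schwartz approximation suffices, and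
the transform of `mult a g` need not be identified. -/
theorem eLpNorm_mult_two_le (a : 𝓢(E3, ℂ)) (g : Lp F 2 (volume : Measure E3)) :
    eLpNorm (mult a g) 2 volume ≤ eLpNorm (fun ξ => a ξ • (𝓕 g : Lp F 2 (volume : Measure E3)) ξ) 2
      volume := by
  obtain ⟨f, hf⟩ := exists_schwartz_approx (Lp.memLp g)
  have hu := tendsto_mult a (Lp.memLp g) hf
  have hmeas : ∀ n, AEStronglyMeasurable (mult a (f n)) volume := fun n =>
    (continuous_mult a ((f n).memLp 2 volume)).aestronglyMeasurable
  have h1 := Lp.eLpNorm_lim_le_liminf_eLpNorm (p := 2) (μ := volume) hmeas (mult a g)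
    (ae_of_all _ fun x => hu.tendsto_at x)
  have hconv := tendsto_eLpNorm_fourier_sub hf
  generalize (𝓕 g : Lp F 2 (volume : Measure E3)) = G at hconv ⊢
  have hlim := (ENNReal.Tendsto.const_mul hconv
    (Or.inr (a.eLpNorm_lt_top ⊤ volume).ne)).add_const (eLpNorm (fun ξ => a ξ • G ξ) 2 volume)
  rw [mul_zero, zero_add] at hlim
  exact h1.trans ((liminf_le_liminf (Eventually.of_forall fun n =>
    eLpNorm_mult_schwartz_le a (f n) (Lp.memLp G).1)).trans_eq hlim.liminf_eq)

end Plancherel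

/-! ### Dyadic numbers -/

theorem lam_pos (q : ℤ) : 0 < lam q := zpow_pos two_pos q

theorem lam_add (p q : ℤ) : lam (p + q) = lam p * lam q := zpow_add₀ two_ne_zero p q

theorem lam_mono {p q : ℤ} (h : p ≤ q) : lam p ≤ lam q := zpow_le_zpow_right₀ one_le_two h

theorem lam_zero : lam 0 = 1 := zpow_zero _

theorem lam_one : lam 1 = 2 := zpow_one _

/-! ### Schwartz symbols -/

/-- A smooth compactly supported real function as a complex Schwartz function. -/
def bumpS (a : E3 → ℝ) (hc : HasCompactSupport a) (hs : ContDiff ℝ ∞ a) : 𝓢(E3, ℂ) :=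
  HasCompactSupport.toSchwartzMap (f := fun ξ => (a ξ : ℂ)) (hc.comp_left Complex.ofReal_zero)
    (Complex.ofRealCLM.contDiff.comp hs)

@[simp] theorem bumpS_apply (a : E3 → ℝ) (hc : HasCompactSupport a) (hs : ContDiff ℝ ∞ a) (ξ : E3) :
    bumpS a hc hs ξ = (a ξ : ℂ) := rfl

variable {χ : E3 → ℝ}

theorem IsCutoff.hasCompactSupport (hχ : IsCutoff χ) : HasCompactSupport χ := by
  refine HasCompactSupport.of_support_subset_isCompact (isCompact_closedBall (0 : E3) 1) ?_
  intro ξ hξ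
  rw [mem_closedBall_zero_iff]
  by_contra! h
  exact hξ (hχ.eq_zero ξ h.le)

theorem hasCompactSupport_dilate {a : E3 → ℝ} (ha : HasCompactSupport a) {c : ℝ} (hc : c ≠ 0) :
    HasCompactSupport (fun ξ => a (c • ξ)) :=
  ha.comp_homeomorph (Homeomorph.smulOfNeZero c hc)

/-- The low pass symbol `χ(λ_q⁻¹ ξ)`. -/
def lowS (hχ : IsCutoff χ) (q : ℤ) : 𝓢(E3, ℂ) :=
  bumpS (fun ξ => χ ((lam q)⁻¹ • ξ))
    (hasCompactSupport_dilate hχ.hasCompactSupport (inv_ne_zero (lam_pos q).ne'))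
    (hχ.smooth.comp (contDiff_const_smul _))

theorem lowS_apply (hχ : IsCutoff χ) (q : ℤ) (ξ : E3) : lowS hχ q ξ = (χ ((lam q)⁻¹ • ξ) : ℂ) := rfl

/-- The dyadic symbol `φ_q` as a Schwartz function. -/
def symS (hχ : IsCutoff χ) (q : ℤ) : 𝓢(E3, ℂ) :=
  if 0 ≤ q then lowS hχ (q + 1) - lowS hχ q else if q = -1 then lowS hχ 0 else 0

theorem symS_of_nonneg (hχ : IsCutoff χ) {q : ℤ} (hq : 0 ≤ q) :
    symS hχ q = lowS hχ (q + 1) - lowS hχ q := if_pos hq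

theorem symS_neg_one (hχ : IsCutoff χ) : symS hχ (-1) = lowS hχ 0 := by simp [symS]

theorem symS_apply (hχ : IsCutoff χ) (q : ℤ) (ξ : E3) : symS hχ q ξ = (symbol χ q ξ : ℂ) := by
  unfold symS symbol annulus
  split_ifs with h1 h2
  · simp only [sub_apply, lowS_apply, Complex.ofReal_sub, smul_smul, lam_add, lam_one, mul_inv]
    rw [mul_comm]
  · simp [lowS_apply, lam_zero]
  · simp

theorem IsCutoff.even (hχ : IsCutoff χ) (ξ : E3) : χ (-ξ) = χ ξ := hχ.radial _ _ (norm_neg ξ)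

theorem symbol_even (hχ : IsCutoff χ) (q : ℤ) (ξ : E3) : symbol χ q (-ξ) = symbol χ q ξ := by
  simp only [symbol, annulus, smul_neg, hχ.even]

theorem fourierInv_ofReal_even {a : E3 → ℝ} (ha : ∀ ξ, a (-ξ) = a ξ) (y : E3) :
    (((𝓕⁻ (fun ξ => (a ξ : ℂ)) y).re : ℝ) : ℂ) = 𝓕⁻ (fun ξ => (a ξ : ℂ)) y := by
  rw [← Complex.conj_eq_iff_re, Real.fourierInv_eq', ← integral_conj,
    ← integral_neg_eq_self]
  congr 1
  ext ξ
  simp only [smul_eq_mul, map_mul, Complex.conj_ofReal, ha, ← Complex.exp_conj, inner_neg_left]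
  congr 2
  simp

theorem ofReal_kernel (hχ : IsCutoff χ) (q : ℤ) (y : E3) :
    (kernel χ q y : ℂ) = ckernel (symS hχ q) y := by
  rw [kernel, fourierInv_ofReal_even (symbol_even hχ q), ckernel, SchwartzMap.fourierInv_coe]
  refine congrFun (congrArg _ (funext fun ξ => ?_)) y
  exact (symS_apply hχ q ξ).symm

/-- Where the narrow cutoff is nonzero, `‖ξ‖ < λ_p ≤ λ_q / 2 < 3λ_q / 4`, so the wide one equals
`1`. -/
theorem smulS_lowS_of_lt (hχ : IsCutoff χ) {p q : ℤ} (h : p < q) :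
    smulS (lowS hχ q) (lowS hχ p) = lowS hχ p := by
  ext ξ
  simp only [smulS, SchwartzMap.pairing_apply_apply, ContinuousLinearMap.lsmul_apply, smul_eq_mul,
    lowS_apply]
  rcases le_or_gt 1 ‖(lam p)⁻¹ • ξ‖ with h1 | h1
  · rw [hχ.eq_zero _ h1]; simp
  · rw [hχ.eq_one ((lam q)⁻¹ • ξ)]
    · simp
    · rw [norm_smul, norm_inv, Real.norm_of_nonneg (lam_pos _).le] at h1 ⊢
      have h2 : lam q = lam p * lam (q - p) := by rw [← lam_add]; congr 1; ring
      have h3 : 2 ≤ lam (q - p) := by rw [← lam_one]; exact lam_mono (by omega)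
      rw [inv_mul_lt_iff₀ (lam_pos p)] at h1
      rw [inv_mul_le_iff₀ (lam_pos q), h2]
      nlinarith [lam_pos p]

theorem smulS_lowS_comm (hχ : IsCutoff χ) (p q : ℤ) :
    smulS (lowS hχ q) (lowS hχ p) = smulS (lowS hχ p) (lowS hχ q) := by
  ext ξ
  simp [smulS, mul_comm]

theorem smulS_sub {F : Type*} [NormedAddCommGroup F] [NormedSpace ℂ F] (a : 𝓢(E3, ℂ))
    (f g : 𝓢(E3, F)) : smulS a (f - g) = smulS a f - smulS a g := map_sub _ _ _

theorem sub_smulS {F : Type*} [NormedAddCommGroup F] [NormedSpace ℂ F] (a b : 𝓢(E3, ℂ))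
    (f : 𝓢(E3, F)) : smulS (a - b) f = smulS a f - smulS b f := by
  ext; simp [smulS]

/-- Reproducing identity: a block is unchanged by a wide enough low pass filter. It yields both
Bernstein's inequality and the blocks of the low modes. -/
theorem smulS_lowS_symS (hχ : IsCutoff χ) {p q : ℤ} (h : q + 1 < p) (hp : 0 < p) :
    smulS (lowS hχ p) (symS hχ q) = symS hχ q := by
  unfold symS
  split_ifs with h1 h2
  · rw [smulS_sub, smulS_lowS_of_lt hχ h, smulS_lowS_of_lt hχ (by omega)]
  · rw [smulS_lowS_of_lt hχ hp]
  · exact map_zero _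

/-- The sum telescopes, since `φ_q = χ(λ_{q+1}⁻¹ ·) - χ(λ_q⁻¹ ·)` for `q ≥ 0`. -/
theorem sum_symS (hχ : IsCutoff χ) (Q : ℕ) :
    ∑ q ∈ Finset.Icc (-1 : ℤ) Q, symS hχ q = lowS hχ (Q + 1) := by
  induction Q with
  | zero =>
    rw [show Finset.Icc (-1 : ℤ) ((0 : ℕ) : ℤ) = {-1, 0} by rfl, Finset.sum_pair (by decide),
      symS_neg_one, symS_of_nonneg hχ le_rfl]
    simp
  | succ n ih =>
    have : Finset.Icc (-1 : ℤ) ((n + 1 : ℕ) : ℤ) = insert ((n : ℤ) + 1) (Finset.Icc (-1 : ℤ) n) := by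
      ext x; simp only [Finset.mem_Icc, Finset.mem_insert]; push_cast; omega
    rw [this, Finset.sum_insert (by simp), ih, symS_of_nonneg hχ (by positivity)]
    push_cast
    abel

/-! ### Complexification -/

theorem norm_complexify (v : E3) : ‖complexify v‖ = ‖v‖ := by
  simp [complexify, EuclideanSpace.norm_eq]

/-- `complexify` as an isometry. -/
def complexifyₗᵢ : E3 →ₗᵢ[ℝ] EuclideanSpace ℂ (Fin 3) := ⟨complexify.toLinearMap, norm_complexify⟩

theorem complexify_smul (a : ℝ) (v : E3) : complexify (a • v) = (a : ℂ) • complexify v := by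
  rw [map_smul, Complex.coe_smul]

theorem complexify_block (hχ : IsCutoff χ) (q : ℤ) (v : E3 → E3) (x : E3) :
    complexify (block χ q v x) = mult (symS hχ q) (fun y => complexify (v y)) x := by
  have h := complexifyₗᵢ.integral_comp_comm (μ := volume) (fun y => kernel χ q y • v (x - y))
  refine h.symm.trans (integral_congr_ae (ae_of_all _ fun y => ?_))
  change complexify _ = _
  rw [complexify_smul, ofReal_kernel hχ]

theorem memLp_complexify {v : E3 → E3} {r : ℝ≥0∞} (hv : MemLp v r volume) :
    MemLp (fun y => complexify (v y)) r volume := complexify.comp_memLp' hv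

theorem eLpNorm_complexify (v : E3 → E3) (r : ℝ≥0∞) :
    eLpNorm (fun y => complexify (v y)) r volume = eLpNorm v r volume :=
  eLpNorm_congr_norm_ae (ae_of_all _ fun y => norm_complexify (v y))

theorem eLpNorm_block (hχ : IsCutoff χ) (q : ℤ) (v : E3 → E3) (r : ℝ≥0∞) :
    eLpNorm (block χ q v) r volume =
      eLpNorm (mult (symS hχ q) (fun y => complexify (v y))) r volume := by
  rw [← eLpNorm_complexify]
  congr 1
  ext1 x
  exact complexify_block hχ q v x

theorem complexify_injective : Function.Injective complexify := complexifyₗᵢ.injective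

theorem continuous_block (hχ : IsCutoff χ) (q : ℤ) {v : E3 → E3} (hv : MemLp v 2 volume) :
    Continuous (block χ q v) := by
  rw [complexifyₗᵢ.isometry.isEmbedding.continuous_iff]
  exact (continuous_mult (symS hχ q) (memLp_complexify hv)).congr fun x =>
    (complexify_block hχ q v x).symm

theorem block_sub (hχ : IsCutoff χ) (q : ℤ) (v w : L2) (x : E3) :
    block χ q (⇑(v - w)) x = block χ q v x - block χ q w x := by
  apply complexify_injective
  rw [map_sub, complexify_block hχ, complexify_block hχ, complexify_block hχ,
    ← mult_sub_right _ one_le_two (memLp_complexify (Lp.memLp v)) (memLp_complexify (Lp.memLp w))]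
  refine mult_congr_ae _ ?_ x
  filter_upwards [Lp.coeFn_sub v w] with y hy
  rw [hy, Pi.sub_apply, map_sub]

/-! ### Scaling of kernels and Bernstein's inequality -/

theorem ckernel_scale {a b : 𝓢(E3, ℂ)} {c : ℝ} (hc : 0 < c) {k : ℂ}
    (h : ∀ ξ, a ξ = k * b (c⁻¹ • ξ)) (y : E3) :
    ckernel a y = (k * (c : ℂ) ^ 3) * ckernel b (c • y) := by
  rw [ckernel, ckernel, SchwartzMap.fourierInv_coe, SchwartzMap.fourierInv_coe,
    Real.fourierInv_eq', Real.fourierInv_eq']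
  have h1 := Measure.integral_comp_inv_smul (volume : Measure E3)
    (fun ξ => Complex.exp (↑(2 * Real.pi * inner ℝ ξ (c • y)) * Complex.I) • b ξ) c
  have h3 : |c ^ Module.finrank ℝ E3| = c ^ 3 := by
    rw [finrank_euclideanSpace_fin, abs_of_pos (by positivity)]
  rw [h3] at h1
  have h2 : ∀ ξ, Complex.exp (↑(2 * Real.pi * inner ℝ ξ y) * Complex.I) • a ξ =
      k * (Complex.exp (↑(2 * Real.pi * inner ℝ (c⁻¹ • ξ) (c • y)) * Complex.I) •
        b (c⁻¹ • ξ)) := by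
    intro ξ
    rw [h, inner_smul_left, inner_smul_right]
    have : (starRingEnd ℝ) c⁻¹ * (c * inner ℝ ξ y) = inner ℝ ξ y := by
      simp [hc.ne']
    rw [this]
    simp only [smul_eq_mul]
    ring
  simp_rw [h2]
  rw [integral_const_mul, h1, mul_assoc]
  simp

theorem eLpNorm_comp_smul (f : 𝓢(E3, ℂ)) {c : ℝ} (hc : 0 < c) (p : ℝ≥0∞) :
    eLpNorm (fun y => f (c • y)) p volume =
      ENNReal.ofReal (c ^ (-(3 * (p⁻¹).toReal))) * eLpNorm f p volume := by
  have h1 := Measure.map_addHaar_smul (volume : Measure E3) hc.ne'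
  have h2 : AEMeasurable (fun y : E3 => c • y) volume := by fun_prop
  have h3 := eLpNorm_map_measure (p := p) (f := fun y : E3 => c • y) (g := f) (μ := volume)
    f.continuous.aestronglyMeasurable h2
  have h4 : (fun x : E3 => c • x) = (c • · : E3 → E3) := rfl
  rw [h4, h1, eLpNorm_smul_measure_of_ne_zero] at h3
  · change eLpNorm (f ∘ fun y => c • y) p volume = _
    rw [← h3, smul_eq_mul, finrank_euclideanSpace_fin, abs_of_pos (by positivity), one_div,
      ENNReal.ofReal_rpow_of_pos (by positivity), ← Real.rpow_natCast,
      ← Real.rpow_neg hc.le, ← Real.rpow_mul hc.le]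
    congr 3
    push_cast; ring
  · simp [hc.ne']

theorem holder_toReal (p r : ℝ≥0∞) [h : ENNReal.HolderConjugate p r] :
    (p⁻¹).toReal + (r⁻¹).toReal = 1 := by
  have := h.inv_add_inv_eq_inv
  rw [inv_one] at this
  rw [← ENNReal.toReal_add _ _, this, ENNReal.toReal_one]
  · intro h0; rw [h0] at this; simp at this
  · intro h0; rw [h0] at this; simp at this

/-- The kernel gains `c³` and the dilation costs `c^{-3/p}`; for conjugate exponents `3 - 3/p =
3/r`, which is the Bernstein factor. -/
theorem eLpNorm_ckernel_scale {a b : 𝓢(E3, ℂ)} {c : ℝ} (hc : 0 < c) {k : ℂ}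
    (h : ∀ ξ, a ξ = k * b (c⁻¹ • ξ)) (p r : ℝ≥0∞) [ENNReal.HolderConjugate p r] :
    eLpNorm (ckernel a) p volume =
      ‖k‖ₑ * ENNReal.ofReal (c ^ threeDiv r) * eLpNorm (ckernel b) p volume := by
  have h1 : (⇑(ckernel a)) = (k * (c : ℂ) ^ 3) • fun y => ckernel b (c • y) := by
    ext1 y; exact ckernel_scale hc h y
  rw [h1, eLpNorm_const_smul, eLpNorm_comp_smul _ hc, enorm_mul, mul_assoc, mul_assoc, ← mul_assoc _ _ (eLpNorm _ _ _)]
  congr 2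
  have h2 : ‖(c : ℂ) ^ 3‖ₑ = ENNReal.ofReal (c ^ (3 : ℝ)) := by
    rw [← ofReal_norm, norm_pow, Complex.norm_real, Real.norm_of_nonneg hc.le]
    norm_cast
  rw [h2, ← ENNReal.ofReal_mul (by positivity), ← Real.rpow_add hc]
  congr 2
  have := holder_toReal p r
  unfold threeDiv
  linarith

theorem lowS_dilate (hχ : IsCutoff χ) (q : ℤ) (ξ : E3) :
    lowS hχ q ξ = 1 * lowS hχ 0 ((lam q)⁻¹ • ξ) := by
  simp [lowS_apply, lam_zero]

/-- Bernstein's inequality. -/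
theorem exists_bernstein (hχ : IsCutoff χ) {r : ℝ≥0∞} (hr : 1 ≤ r) :
    ∃ C : ℝ≥0∞, C ≠ ⊤ ∧ ∀ q : ℤ, -1 ≤ q → ∀ v : E3 → E3, MemLp v 2 volume → ∀ x,
      ‖block χ q v x‖ₑ ≤ C * ENNReal.ofReal (lam q ^ threeDiv r) * eLpNorm (block χ q v) r volume := by
  have : ENNReal.HolderConjugate (ENNReal.conjExponent r) r :=
    (ENNReal.HolderConjugate.conjExponent hr).symm
  refine ⟨ENNReal.ofReal (lam 2 ^ threeDiv r) *
    eLpNorm (ckernel (lowS hχ 0)) (ENNReal.conjExponent r) volume,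
    ENNReal.mul_ne_top ENNReal.ofReal_ne_top (SchwartzMap.eLpNorm_lt_top _ _ _).ne,
    fun q hq v hv x => ?_⟩
  have hv' := memLp_complexify hv
  have h1 : ‖block χ q v x‖ₑ = ‖mult (symS hχ q) (fun y => complexify (v y)) x‖ₑ := by
    rw [← complexify_block, enorm_eq_iff_norm_eq, norm_complexify]
  -- The rewriting back and forth puts the low pass filter of index `q + 2` in front of the block on
  -- the left only; Hölder against its kernel then gives the bound.
  rw [h1, eLpNorm_block hχ, ← smulS_lowS_symS hχ (show q + 1 < q + 2 by omega) (by omega),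
    ← mult_mult _ _ hv', smulS_lowS_symS hχ (show q + 1 < q + 2 by omega) (by omega)]
  refine (enorm_mult_le _ (continuous_mult _ hv').aestronglyMeasurable (ENNReal.conjExponent r) r
    x).trans ?_
  rw [eLpNorm_ckernel_scale (lam_pos (q + 2)) (lowS_dilate hχ (q + 2)) _ r, lam_add,
    Real.mul_rpow (lam_pos _).le (lam_pos _).le, ENNReal.ofReal_mul (by positivity [lam_pos q])]
  apply le_of_eq
  simp only [enorm_one]
  ring

/-! ### Decay of the blocks of an `H^s` field -/

theorem symbol_eq_zero (hχ : IsCutoff χ) {q : ℤ} (hq : 0 ≤ q) {ξ : E3} (h : ‖ξ‖ ≤ 3 / 4 * lam q) :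
    symbol χ q ξ = 0 := by
  have h1 : ‖(lam q)⁻¹ • ξ‖ ≤ 3 / 4 := by
    rw [norm_smul, norm_inv, Real.norm_of_nonneg (lam_pos _).le, inv_mul_le_iff₀ (lam_pos q)]
    linarith
  have h2 : ‖(2 : ℝ)⁻¹ • (lam q)⁻¹ • ξ‖ ≤ 3 / 4 := by
    rw [norm_smul, norm_inv, Real.norm_two]
    linarith [norm_nonneg ((lam q)⁻¹ • ξ)]
  rw [symbol, if_pos hq, annulus, hχ.eq_one _ h1, hχ.eq_one _ h2, sub_self]

theorem exists_symbol_bound (hχ : IsCutoff χ) :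
    ∃ B : ℝ, 0 < B ∧ ∀ q : ℤ, 0 ≤ q → ∀ ξ, |symbol χ q ξ| ≤ B := by
  obtain ⟨M, hM⟩ := hχ.hasCompactSupport.exists_bound_of_continuous hχ.smooth.continuous
  have hM0 : 0 ≤ M := (norm_nonneg _).trans (hM 0)
  refine ⟨M + M + 1, by positivity, fun q hq ξ => ?_⟩
  rw [symbol, if_pos hq, annulus]
  have h1 := hM ((2 : ℝ)⁻¹ • (lam q)⁻¹ • ξ)
  have h2 := hM ((lam q)⁻¹ • ξ)
  rw [Real.norm_eq_abs] at h1 h2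
  exact (abs_sub _ _).trans (by linarith)

/-- Where `φ_q` is nonzero, `‖ξ‖ > 3λ_q / 4`, so the weight `(1 + ‖ξ‖²)^s` is at least `(3λ_q /
4)^{2s}`; Plancherel does the rest. -/
theorem exists_block_sobolev (hχ : IsCutoff χ) {s : ℝ} (hs : 0 ≤ s) :
    ∃ C : ℝ≥0∞, C ≠ ⊤ ∧ ∀ q : ℤ, 0 ≤ q → ∀ v : L2,
      eLpNorm (block χ q v) 2 volume ≤ C * ENNReal.ofReal (lam q ^ (-s)) * sobolevNorm s v := by
  obtain ⟨B, hB0, hB⟩ := exists_symbol_bound hχ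
  refine ⟨ENNReal.ofReal (B * (3 / 4) ^ (-s)), ENNReal.ofReal_ne_top, fun q hq v => ?_⟩
  have hl := lam_pos q
  set D : ℝ := B * (3 / 4) ^ (-s) * lam q ^ (-s) with hD
  have hD0 : 0 ≤ D := by positivity
  have hpt : ∀ ξ, |symbol χ q ξ| ^ 2 ≤ D ^ 2 * (1 + ‖ξ‖ ^ 2) ^ s := by
    intro ξ
    rcases le_or_gt ‖ξ‖ (3 / 4 * lam q) with h | h
    · rw [symbol_eq_zero hχ hq h]
      simp; positivity
    · have h1 : (3 / 4 * lam q) ^ (2 * s) ≤ (1 + ‖ξ‖ ^ 2) ^ s := by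
        rw [Real.rpow_mul (by positivity)]
        refine Real.rpow_le_rpow (by positivity) ?_ hs
        rw [Real.rpow_two]
        nlinarith
      have h2 : D ^ 2 * (3 / 4 * lam q) ^ (2 * s) = B ^ 2 := by
        rw [hD, mul_assoc, ← Real.mul_rpow (by norm_num) hl.le, mul_pow, mul_assoc, ← Real.rpow_two,
          ← Real.rpow_two, ← Real.rpow_mul (by positivity), ← Real.rpow_add (by positivity)]
        rw [show -s * 2 + 2 * s = 0 by ring, Real.rpow_zero, mul_one]
      calc |symbol χ q ξ| ^ 2 ≤ B ^ 2 := by gcongr; exact hB q hq ξ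
        _ = D ^ 2 * (3 / 4 * lam q) ^ (2 * s) := h2.symm
        _ ≤ _ := by gcongr
  have hv : eLpNorm (block χ q v) 2 volume ≤
      eLpNorm (fun ξ => symS hχ q ξ • fourierL2 v ξ) 2 volume := by
    rw [eLpNorm_block hχ]
    refine le_trans (le_of_eq ?_) (eLpNorm_mult_two_le (symS hχ q) (complexify.compLp v))
    congr 1
    ext1 x
    refine mult_congr_ae _ ?_ x
    filter_upwards [complexify.coeFn_compLp v] with y hy
    rw [hy]
  refine hv.trans ?_
  rw [eLpNorm_eq_lintegral_rpow_enorm_toReal (by simp) (by simp), ENNReal.toReal_ofNat,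
    ← ENNReal.ofReal_mul (by positivity), ← hD, sobolevNorm]
  have hDe : ENNReal.ofReal D = (ENNReal.ofReal (D ^ 2)) ^ (1 / 2 : ℝ) := by
    rw [ENNReal.ofReal_rpow_of_nonneg (by positivity) (by norm_num), ← Real.sqrt_eq_rpow,
      Real.sqrt_sq hD0]
  rw [hDe, ← ENNReal.mul_rpow_of_nonneg _ _ (by norm_num)]
  refine ENNReal.rpow_le_rpow ?_ (by norm_num)
  rw [← lintegral_const_mul' _ _ ENNReal.ofReal_ne_top]
  refine lintegral_mono fun ξ => ?_
  rw [enorm_smul, ENNReal.mul_rpow_of_nonneg _ _ (by norm_num), ← mul_assoc,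
    ← ENNReal.ofReal_mul (by positivity)]
  gcongr
  rw [symS_apply, ← ofReal_norm, Complex.norm_real, Real.norm_eq_abs,
    ENNReal.ofReal_rpow_of_nonneg (abs_nonneg _) (by norm_num), Real.rpow_two]
  exact ENNReal.ofReal_le_ofReal (hpt ξ)

/-- Interpolation between `L²` and `L^∞`. -/
theorem eLpNorm_le_of_enorm_le {F : Type*} [NormedAddCommGroup F] {f : E3 → F} {D : ℝ≥0∞}
    {r : ℝ≥0∞} (hr : 2 ≤ r) (hD : ∀ x, ‖f x‖ₑ ≤ D * eLpNorm f 2 volume) :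
    eLpNorm f r volume ≤ D ^ (1 - 2 * (r⁻¹).toReal) * eLpNorm f 2 volume := by
  rcases eq_or_ne r ⊤ with rfl | hr'
  · simp only [ENNReal.inv_top, ENNReal.toReal_zero, mul_zero, sub_zero, ENNReal.rpow_one]
    rw [eLpNorm_exponent_top]
    exact eLpNormEssSup_le_of_ae_enorm_bound (ae_of_all _ hD)
  have hr2 : 2 ≤ r.toReal := by
    rw [← ENNReal.toReal_ofNat]; exact ENNReal.toReal_mono hr' hr
  have hr0 : r ≠ 0 := by rintro rfl; simp at hr
  set X := eLpNorm f 2 volume with hX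
  have hX2 : ∫⁻ x, ‖f x‖ₑ ^ (2 : ℝ) = X ^ (2 : ℝ) := by
    rw [hX, eLpNorm_eq_lintegral_rpow_enorm_toReal (by simp) (by simp), ENNReal.toReal_ofNat,
      ← ENNReal.rpow_mul]
    norm_num
  set ρ := r.toReal with hρ
  have h1 : ∫⁻ x, ‖f x‖ₑ ^ ρ ≤ (D * X) ^ (ρ - 2) * X ^ (2 : ℝ) := by
    rw [← hX2]
    -- A finite factor can be pulled out of the integral. If it is infinite, so is the right side,
    -- unless `X = 0`; but then the factor would be finite.
    rcases eq_or_ne ((D * X) ^ (ρ - 2)) ⊤ with h | h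
    · rw [h]
      rcases eq_or_ne (∫⁻ x, ‖f x‖ₑ ^ (2 : ℝ)) 0 with h0 | h0
      · rw [hX2] at h0
        have hX0 : X = 0 := by simpa using h0
        rw [hX0, mul_zero] at h
        rcases eq_or_lt_of_le hr2 with h3 | h3
        · rw [← h3] at h; simp at h
        · rw [ENNReal.zero_rpow_of_pos (by linarith)] at h; simp at h
      · rw [ENNReal.top_mul h0]; exact le_top
    · rw [← lintegral_const_mul' _ _ h]
      refine lintegral_mono fun x => ?_
      calc ‖f x‖ₑ ^ ρ = ‖f x‖ₑ ^ (ρ - 2) * ‖f x‖ₑ ^ (2 : ℝ) := by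
            rw [← ENNReal.rpow_add_of_nonneg _ _ (by linarith) (by norm_num)]
            congr 1; ring
        _ ≤ _ := by gcongr; exact hD x
  rw [eLpNorm_eq_lintegral_rpow_enorm_toReal hr0 hr', ← hρ]
  have hρ0 : 0 < ρ := by linarith
  calc (∫⁻ x, ‖f x‖ₑ ^ ρ) ^ (1 / ρ) ≤ ((D * X) ^ (ρ - 2) * X ^ (2 : ℝ)) ^ (1 / ρ) :=
        ENNReal.rpow_le_rpow h1 (by positivity)
    _ = (D ^ (ρ - 2) * X ^ ρ) ^ (1 / ρ) := by
        rw [ENNReal.mul_rpow_of_nonneg D X (by linarith), mul_assoc,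
          ← ENNReal.rpow_add_of_nonneg _ _ (by linarith) (by norm_num), sub_add_cancel]
    _ = _ := by
        rw [ENNReal.mul_rpow_of_nonneg _ _ (by positivity), ← ENNReal.rpow_mul, ← ENNReal.rpow_mul,
          mul_one_div_cancel hρ0.ne', ENNReal.rpow_one, ENNReal.toReal_inv, ← hρ]
        congr 2
        field_simp

/-- Exponent count: `(-1 + 3/r) + (3/2)(1 - 2/r) - s = 1/2 - s`, the middle term coming from
interpolation between `L²` and the `L^∞` bound of Bernstein. -/
theorem exists_weightedBlock_sobolev (hχ : IsCutoff χ) {r : ℝ≥0∞} (hr : 2 ≤ r) {s : ℝ}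
    (hs : 0 ≤ s) : ∃ C : ℝ≥0∞, C ≠ ⊤ ∧ ∀ q : ℤ, 0 ≤ q → ∀ v : L2,
      weightedBlock χ (-1 + threeDiv r) r q v ≤
        C * ENNReal.ofReal (lam q ^ (1 / 2 - s)) * sobolevNorm s v := by
  obtain ⟨C₁, hC₁, h₁⟩ := exists_bernstein hχ (one_le_two (α := ℝ≥0∞))
  obtain ⟨C₂, hC₂, h₂⟩ := exists_block_sobolev hχ hs
  set θ := 1 - 2 * (r⁻¹).toReal with hθ
  have hθ0 : 0 ≤ θ := by
    have : (r⁻¹).toReal ≤ 2⁻¹ := by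
      have := ENNReal.toReal_mono (by simp) (ENNReal.inv_le_inv.2 hr)
      simpa using this
    linarith
  refine ⟨C₁ ^ θ * C₂, ENNReal.mul_ne_top (ENNReal.rpow_ne_top_of_nonneg hθ0 hC₁) hC₂,
    fun q hq v => ?_⟩
  have hl := lam_pos q
  have h3 := eLpNorm_le_of_enorm_le hr (h₁ q (by omega) v (Lp.memLp v))
  have ht : threeDiv 2 = 3 / 2 := by
    simp [threeDiv]; norm_num
  rw [ENNReal.mul_rpow_of_nonneg _ _ hθ0, ENNReal.ofReal_rpow_of_pos (by positivity),
    ← Real.rpow_mul hl.le, ht] at h3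
  calc weightedBlock χ (-1 + threeDiv r) r q v
      ≤ ENNReal.ofReal (lam q ^ (-1 + threeDiv r)) * (C₁ ^ θ * ENNReal.ofReal (lam q ^ (3 / 2 * θ)) *
        (C₂ * ENNReal.ofReal (lam q ^ (-s)) * sobolevNorm s v)) := by
        unfold weightedBlock
        gcongr
        refine h3.trans ?_
        gcongr
        exact h₂ q hq v
    _ = C₁ ^ θ * C₂ * (ENNReal.ofReal (lam q ^ (-1 + threeDiv r)) *
        ENNReal.ofReal (lam q ^ (3 / 2 * θ)) * ENNReal.ofReal (lam q ^ (-s))) * sobolevNorm s v := by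
        ring
    _ = _ := by
        rw [← ENNReal.ofReal_mul (by positivity), ← ENNReal.ofReal_mul (by positivity),
          ← Real.rpow_add hl, ← Real.rpow_add hl]
        congr 4
        rw [hθ, threeDiv]
        ring

/-! ### Blocks of the low modes -/

theorem complexify_lowModes (hχ : IsCutoff χ) (Q : ℕ) {v : E3 → E3} (hv : MemLp v 2 volume)
    (x : E3) : complexify (lowModes χ Q v x) =
      mult (lowS hχ (Q + 1)) (fun y => complexify (v y)) x := by
  rw [← sum_symS, mult_sum_left _ _ one_le_two (memLp_complexify hv), lowModes,
    if_neg (ENat.natCast_ne_top Q), map_sum, ENat.toNat_natCast]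
  exact Finset.sum_congr rfl fun q _ => complexify_block hχ q v x

theorem complexify_block_lowModes (hχ : IsCutoff χ) (p : ℤ) (Q : ℕ) {v : E3 → E3}
    (hv : MemLp v 2 volume) (x : E3) : complexify (block χ p (lowModes χ Q v) x) =
      mult (smulS (symS hχ p) (lowS hχ (Q + 1))) (fun y => complexify (v y)) x := by
  rw [complexify_block hχ, ← mult_mult _ _ (memLp_complexify hv)]
  congr 1
  ext1 y
  exact complexify_lowModes hχ Q hv y

theorem block_lowModes_of_lt (hχ : IsCutoff χ) {p : ℤ} {Q : ℕ} (h : p < Q) {v : E3 → E3}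
    (hv : MemLp v 2 volume) (x : E3) : block χ p (lowModes χ Q v) x = block χ p v x := by
  apply complexify_injective
  rw [complexify_block_lowModes hχ p Q hv, complexify_block hχ]
  have h1 : smulS (symS hχ p) (lowS hχ (Q + 1)) = smulS (lowS hχ (Q + 1)) (symS hχ p) := by
    ext ξ; simp [smulS, mul_comm]
  rw [h1, smulS_lowS_symS hχ (by omega) (by omega)]

/-- At the top index the cutoff of the low modes is not `1` on the whole support of `φ_Q`, so one
block does not suffice. With `χ_q = χ(λ_q⁻¹ ·)`, one has `(φ_Q + φ_{Q+1}) χ_{Q+1} = (χ_{Q+2} - χ_Q)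
χ_{Q+1} = χ_{Q+1} - χ_Q = φ_Q`. -/
theorem block_eq_add_block_lowModes (hχ : IsCutoff χ) (Q : ℕ) {v : E3 → E3}
    (hv : MemLp v 2 volume) (x : E3) : block χ Q v x =
      block χ Q (lowModes χ Q v) x + block χ (Q + 1) (lowModes χ Q v) x := by
  apply complexify_injective
  have hv' := memLp_complexify hv
  rw [map_add, complexify_block_lowModes hχ _ Q hv, complexify_block_lowModes hχ _ Q hv,
    complexify_block hχ, ← mult_add_left _ _ one_le_two hv', symS_of_nonneg hχ (by positivity),
    symS_of_nonneg hχ (by positivity), sub_smulS, sub_smulS,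
    smulS_lowS_of_lt hχ (show (Q : ℤ) + 1 < Q + 1 + 1 by omega), smulS_lowS_comm hχ _ (Q : ℤ),
    smulS_lowS_of_lt hχ (show (Q : ℤ) < Q + 1 by omega), sub_add_sub_comm]
  congr 1
  abel

/-! ### Derivative symbols and components -/

/-- The `j`-th unit vector. -/
abbrev basisVec (j : Fin 3) : E3 := EuclideanSpace.single j 1

/-- The symbol `2πi ξ_j a(ξ)` of the `j`-th derivative of the multiplier with symbol `a`. -/
def derivS (j : Fin 3) (a : 𝓢(E3, ℂ)) : 𝓢(E3, ℂ) :=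
  (2 * Real.pi * Complex.I) • SchwartzMap.smulLeftCLM ℂ (inner ℝ · (basisVec j)) a

theorem derivS_apply (j : Fin 3) (a : 𝓢(E3, ℂ)) (ξ : E3) :
    derivS j a ξ = 2 * Real.pi * Complex.I * (ξ j : ℂ) * a ξ := by
  have h : (fun y : E3 => inner ℝ y (basisVec j)).HasTemperateGrowth := by fun_prop
  rw [derivS, smul_apply, SchwartzMap.smulLeftCLM_apply_apply h]
  simp [EuclideanSpace.inner_single_right, mul_assoc]

theorem ckernel_derivS (j : Fin 3) (a : 𝓢(E3, ℂ)) (y : E3) :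
    ckernel (derivS j a) y = fderiv ℝ (ckernel a) y (basisVec j) := by
  rw [ckernel, derivS, ← SchwartzMap.lineDerivOp_fourierInv_eq,
    SchwartzMap.lineDerivOp_apply_eq_fderiv]

theorem smulS_derivS (j : Fin 3) (a b : 𝓢(E3, ℂ)) :
    smulS (derivS j a) b = derivS j (smulS a b) := by
  ext ξ
  simp only [smulS, SchwartzMap.pairing_apply_apply, ContinuousLinearMap.lsmul_apply, smul_eq_mul,
    derivS_apply]
  ring

/-- The `i`-th component of a vector field, with complex values. -/
def comp (v : E3 → E3) (i : Fin 3) (y : E3) : ℂ := (v y i : ℂ)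

theorem memLp_comp {v : E3 → E3} {r : ℝ≥0∞} (hv : MemLp v r volume) (i : Fin 3) :
    MemLp (comp v i) r volume :=
  (Complex.ofRealCLM.comp (EuclideanSpace.proj (𝕜 := ℝ) i)).comp_memLp' hv

theorem block_comp (hχ : IsCutoff χ) (q : ℤ) {v : E3 → E3} (hv : MemLp v 2 volume) (x : E3)
    (i : Fin 3) : ((block χ q v x i : ℝ) : ℂ) = mult (symS hχ q) (comp v i) x := by
  have h1 : ((block χ q v x i : ℝ) : ℂ) = complexify (block χ q v x) i := rfl
  rw [h1, complexify_block hχ, mult]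
  have h2 := (EuclideanSpace.proj (𝕜 := ℂ) i).integral_comp_comm
    (integrable_mult (ckernel (symS hχ q)) one_le_two (memLp_complexify hv) x)
  exact h2.symm

/-! ### Divergence free fields -/

/-- Convolution kernels are not compactly supported, so the test function is truncated by `χ(y / (n
+ 1))`. Dominated convergence applies with a majorant that is a product of two `L²` functions. -/
theorem IsDivFree.integral_fderiv_eq_zero (hχ : IsCutoff χ) {v : L2} (hv : IsDivFree v) {ψ : E3 → ℝ}
    (hψ : ContDiff ℝ ∞ ψ) (h2 : MemLp ψ 2 volume) (h2' : MemLp (fderiv ℝ ψ) 2 volume) :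
    ∫ y, fderiv ℝ ψ y (v y) = 0 := by
  have hcd : ∀ n : ℕ, ContDiff ℝ ∞ (fun y : E3 => χ ((n + 1 : ℝ)⁻¹ • y)) := fun n =>
    hχ.smooth.comp (contDiff_const_smul _)
  obtain ⟨M, hM⟩ := hχ.hasCompactSupport.exists_bound_of_continuous hχ.smooth.continuous
  obtain ⟨M', hM'⟩ := (hχ.hasCompactSupport.fderiv (𝕜 := ℝ)).exists_bound_of_continuous
    (hχ.smooth.continuous_fderiv (by simp))
  have hM0 : 0 ≤ M := (norm_nonneg _).trans (hM 0)
  have hM0' : 0 ≤ M' := (norm_nonneg _).trans (hM' 0)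
  have hzero : ∀ n : ℕ, ∫ y, fderiv ℝ (fun y => χ ((n + 1 : ℝ)⁻¹ • y) * ψ y) y (v y) = 0 := by
    intro n
    have := hv (fun y => χ ((n + 1 : ℝ)⁻¹ • y) * ψ y) ((hcd n).mul hψ)
      (HasCompactSupport.mul_right (hasCompactSupport_dilate hχ.hasCompactSupport (by positivity)))
    rw [← this]
    refine integral_congr_ae (ae_of_all _ fun y => ?_)
    simp only
    rw [inner_gradient_right]
    rfl
  have hderiv : ∀ (n : ℕ) (y : E3), ‖fderiv ℝ (fun y => χ ((n + 1 : ℝ)⁻¹ • y) * ψ y) y‖ ≤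
      M * ‖fderiv ℝ ψ y‖ + M' * ‖ψ y‖ := by
    intro n y
    have hd : HasFDerivAt (fun y : E3 => χ ((n + 1 : ℝ)⁻¹ • y))
        ((n + 1 : ℝ)⁻¹ • fderiv ℝ χ ((n + 1 : ℝ)⁻¹ • y)) y := by
      have h1 := (hχ.smooth.differentiable (by simp) ((n + 1 : ℝ)⁻¹ • y)).hasFDerivAt.comp y
        ((hasFDerivAt_id (𝕜 := ℝ) y).const_smul ((n + 1 : ℝ)⁻¹))
      convert! h1 using 1
      ext w; simp
    have hp := hd.mul (hψ.differentiable (by simp) y).hasFDerivAt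
    rw [show (fun y => χ ((n + 1 : ℝ)⁻¹ • y) * ψ y) = (fun y => χ ((n + 1 : ℝ)⁻¹ • y)) * ψ from rfl,
      hp.fderiv]
    refine (norm_add_le _ _).trans (add_le_add ?_ ?_)
    · rw [norm_smul]
      gcongr
      exact hM _
    · rw [norm_smul, norm_smul, mul_comm]
      gcongr
      have : ‖((n : ℝ) + 1)⁻¹‖ ≤ 1 := by
        rw [norm_inv, Real.norm_of_nonneg (by positivity)]
        exact inv_le_one_of_one_le₀ (by linarith [n.cast_nonneg (α := ℝ)])
      calc _ ≤ 1 * M' := mul_le_mul this (hM' _) (norm_nonneg _) zero_le_one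
        _ = M' := one_mul _
  have hlim : Tendsto (fun n : ℕ => ∫ y, fderiv ℝ (fun y => χ ((n + 1 : ℝ)⁻¹ • y) * ψ y) y (v y))
      atTop (𝓝 (∫ y, fderiv ℝ ψ y (v y))) := by
    refine tendsto_integral_of_dominated_convergence
      (fun y => (M * ‖fderiv ℝ ψ y‖ + M' * ‖ψ y‖) * ‖v y‖) (fun n => ?_) ?_ (fun n => ?_) ?_
    · have hc : Continuous (fderiv ℝ (fun y => χ ((n + 1 : ℝ)⁻¹ • y) * ψ y)) :=
        ((hcd n).mul hψ).continuous_fderiv (by simp)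
      exact (ContinuousLinearMap.apply ℝ ℝ).flip.aestronglyMeasurable_comp₂
        hc.aestronglyMeasurable (Lp.memLp v).1
    · exact MemLp.integrable_mul ((h2'.norm.const_mul M).add (h2.norm.const_mul M'))
        (Lp.memLp v).norm
    · refine ae_of_all _ fun y => ((ContinuousLinearMap.le_opNorm _ _).trans ?_)
      gcongr
      exact hderiv n y
    · refine ae_of_all _ fun y => tendsto_const_nhds.congr' ?_
      -- For such `n` the cutoff is `1` near `y`, so the derivative at `y` is already the limit.
      filter_upwards [eventually_ge_atTop ⌈2 * ‖y‖⌉₊] with n hn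
      have hn' : 2 * ‖y‖ ≤ n := Nat.ceil_le.1 hn
      congr 1
      refine Filter.EventuallyEq.fderiv_eq ?_
      have hnear : ∀ᶠ z in 𝓝 y, ‖z‖ < 3 / 4 * (n + 1 : ℝ) :=
        continuous_norm.continuousAt.eventually_lt_const (by linarith [norm_nonneg y])
      filter_upwards [hnear] with z hz
      rw [hχ.eq_one, one_mul]
      rw [norm_smul, norm_inv, Real.norm_of_nonneg (by positivity), inv_mul_le_iff₀ (by positivity)]
      linarith
  exact tendsto_nhds_unique hlim (by simp only [hzero]; exact tendsto_const_nhds)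

theorem fderiv_comp_const_sub {F : Type*} [NormedAddCommGroup F] [NormedSpace ℝ F] {f : E3 → F}
    (x y : E3) (hf : DifferentiableAt ℝ f (x - y)) :
    HasFDerivAt (fun y => f (x - y)) (-fderiv ℝ f (x - y)) y := by
  have h := hf.hasFDerivAt.comp y ((hasFDerivAt_id (𝕜 := ℝ) y).const_sub x)
  convert! h using 1
  ext w; simp

theorem sum_smul_basisVec (w : E3) : ∑ j, w j • basisVec j = w := by
  ext i
  fin_cases i <;> simp [Fin.sum_univ_three]

theorem IsDivFree.sum_mult_derivS (hχ : IsCutoff χ) {v : L2} (hv : IsDivFree v) (a : 𝓢(E3, ℂ))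
    (x : E3) : ∑ j, mult (derivS j a) (comp v j) x = 0 := by
  have hint : ∀ j, Integrable (fun y => ckernel (derivS j a) y • comp v j (x - y)) volume := fun j =>
    integrable_mult _ one_le_two (memLp_comp (Lp.memLp v) j) x
  have h1 : ∑ j, mult (derivS j a) (comp v j) x = ∫ y, fderiv ℝ (ckernel a) y (v (x - y)) := by
    simp only [mult]
    rw [← integral_finsetSum _ fun j _ => hint j]
    refine integral_congr_ae (ae_of_all _ fun y => ?_)
    simp only
    conv_rhs => rw [← sum_smul_basisVec (v (x - y)), map_sum]
    refine Finset.sum_congr rfl fun j _ => ?_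
    have := ckernel_derivS j a y
    rw [ckernel] at this
    rw [this, map_smul, smul_eq_mul, comp, mul_comm, Complex.real_smul]
  have hint' : Integrable (fun y => fderiv ℝ (ckernel a) y (v (x - y))) volume := by
    refine (integrable_finsetSum Finset.univ fun j _ => hint j).congr (ae_of_all _ fun y => ?_)
    simp only
    conv_rhs => rw [← sum_smul_basisVec (v (x - y)), map_sum]
    refine Finset.sum_congr rfl fun j _ => ?_
    rw [ckernel_derivS, map_smul, smul_eq_mul, comp, mul_comm, Complex.real_smul]
  -- Test functions are real, so the real and imaginary parts of the translated, reflected kernel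
  -- are tested separately.
  have key : ∀ L : ℂ →L[ℝ] ℝ, L (∫ y, fderiv ℝ (ckernel a) y (v (x - y))) = 0 := by
    intro L
    rw [← L.integral_comp_comm hint', ← integral_sub_left_eq_self _ volume x]
    simp only [sub_sub_cancel]
    have hN : Differentiable ℝ (ckernel a) := (ckernel a).differentiable
    have hd : ∀ y, HasFDerivAt (fun y => L (ckernel a (x - y)))
        (L.comp (-fderiv ℝ (ckernel a) (x - y))) y := fun y =>
      L.hasFDerivAt.comp y (fderiv_comp_const_sub x y (hN _))
    have hfd : fderiv ℝ (fun y => L (ckernel a (x - y))) =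
        fun y => L.comp (-fderiv ℝ (ckernel a) (x - y)) := funext fun y => (hd y).fderiv
    have h := hv.integral_fderiv_eq_zero hχ (ψ := fun y => L (ckernel a (x - y))) ?_ ?_ ?_
    · rw [hfd] at h
      simp only [ContinuousLinearMap.comp_apply, neg_apply, map_neg] at h
      rw [integral_neg, neg_eq_zero] at h
      exact h
    · exact L.contDiff.comp (((ckernel a).smooth ⊤).comp (contDiff_const.sub contDiff_id))
    · exact L.comp_memLp' (((ckernel a).memLp 2 volume).comp_measurePreserving
        (Measure.measurePreserving_sub_left volume x))
    · rw [hfd]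
      have h3 := ((SchwartzMap.fderivCLM ℝ E3 ℂ (ckernel a)).memLp 2 volume).comp_measurePreserving
        (Measure.measurePreserving_sub_left volume x)
      have h4 := ((ContinuousLinearMap.compL ℝ E3 ℂ ℝ L).comp_memLp' h3).neg
      refine h4.ae_eq (ae_of_all _ fun y => ?_)
      ext w
      simp
  rw [h1]
  apply Complex.ext
  · exact key Complex.reCLM
  · exact key Complex.imCLM

/-! ### The blocks of the vorticity -/

theorem fderiv_kernel (hχ : IsCutoff χ) (q : ℤ) (y w : E3) :
    ((fderiv ℝ (kernel χ q) y w : ℝ) : ℂ) = fderiv ℝ (ckernel (symS hχ q)) y w := by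
  have h1 : kernel χ q = fun y => Complex.reCLM (ckernel (symS hχ q) y) := by
    ext1 y; rw [← ofReal_kernel hχ]; simp
  have h2 : DifferentiableAt ℝ (kernel χ q) y := by
    rw [h1]; exact Complex.reCLM.differentiableAt.comp y (SchwartzMap.differentiableAt _)
  have h3 : ⇑(ckernel (symS hχ q)) = fun y => Complex.ofRealCLM (kernel χ q y) := by
    ext1 y; exact (ofReal_kernel hχ q y).symm
  rw [h3]
  have := Complex.ofRealCLM.hasFDerivAt.comp y h2.hasFDerivAt
  rw [show (fun y => Complex.ofRealCLM (kernel χ q y)) = Complex.ofRealCLM ∘ kernel χ q from rfl,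
    this.fderiv]
  rfl

theorem differentiable_kernel (hχ : IsCutoff χ) (q : ℤ) : Differentiable ℝ (kernel χ q) := by
  have h1 : kernel χ q = fun y => Complex.reCLM (ckernel (symS hχ q) y) := by
    ext1 y; rw [← ofReal_kernel hχ]; simp
  rw [h1]
  exact Complex.reCLM.differentiable.comp (SchwartzMap.differentiable _)

theorem gradient_kernel (hχ : IsCutoff χ) (q : ℤ) (x y : E3) (j : Fin 3) :
    (((∇ (fun y => kernel χ q (x - y)) y) j : ℝ) : ℂ) = -ckernel (derivS j (symS hχ q)) (x - y) := by
  have h1 : (∇ (fun y => kernel χ q (x - y)) y) j =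
      inner ℝ (∇ (fun y => kernel χ q (x - y)) y) (basisVec j) := by
    rw [EuclideanSpace.inner_single_right]; simp
  rw [h1, inner_gradient_left,
    (fderiv_comp_const_sub x y (differentiable_kernel hχ q (x - y))).fderiv, ckernel_derivS,
    ← fderiv_kernel]
  simp

/-- The curl components `∂_j v_i - ∂_i v_j` of the block. -/
def curlPart (hχ : IsCutoff χ) (q : ℤ) (v : E3 → E3) (i j : Fin 3) (x : E3) : ℂ :=
  mult (derivS j (symS hχ q)) (comp v i) x - mult (derivS i (symS hχ q)) (comp v j) x

theorem integral_curlPart (hχ : IsCutoff χ) (q : ℤ) {v : E3 → E3} (hv : MemLp v 2 volume)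
    (i j : Fin 3) (x : E3) :
    Integrable (fun y => v y i * (∇ (fun y => kernel χ q (x - y)) y) j -
      v y j * (∇ (fun y => kernel χ q (x - y)) y) i) volume ∧
    ((∫ y, (v y i * (∇ (fun y => kernel χ q (x - y)) y) j -
      v y j * (∇ (fun y => kernel χ q (x - y)) y) i) : ℝ) : ℂ) = -curlPart hχ q v i j x := by
  have hI : ∀ i j, Integrable (fun y => ckernel (derivS j (symS hχ q)) (x - y) * comp v i y) volume :=
    fun i j => by
      have := (integrable_mult (ckernel (derivS j (symS hχ q))) one_le_two (memLp_comp hv i)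
        x).comp_sub_left x
      simpa using this
  have hM : ∀ i j, mult (derivS j (symS hχ q)) (comp v i) x =
      ∫ y, ckernel (derivS j (symS hχ q)) (x - y) * comp v i y := fun i j => by
    rw [mult, ← integral_sub_left_eq_self _ volume x]
    simp
  have hpt : ∀ y, ((v y i * (∇ (fun y => kernel χ q (x - y)) y) j -
      v y j * (∇ (fun y => kernel χ q (x - y)) y) i : ℝ) : ℂ) =
      ckernel (derivS i (symS hχ q)) (x - y) * comp v j y -
        ckernel (derivS j (symS hχ q)) (x - y) * comp v i y := by
    intro y
    push_cast
    rw [gradient_kernel hχ, gradient_kernel hχ, comp, comp]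
    ring
  constructor
  · refine (((hI j i).sub (hI i j)).re).congr (ae_of_all _ fun y => ?_)
    simp only [Pi.sub_apply]
    rw [← hpt]
    simp
  · rw [← integral_complex_ofReal]
    simp_rw [hpt]
    rw [integral_sub (hI j i) (hI i j), curlPart, hM, hM, neg_sub]

/-- For `i ≠ j` the curl part is, up to sign, a coordinate of the vorticity block; for `i = j` it is
zero. -/
theorem enorm_curlPart_le (hχ : IsCutoff χ) (q : ℤ) {v : E3 → E3} (hv : MemLp v 2 volume)
    (i j : Fin 3) (x : E3) : ‖curlPart hχ q v i j x‖ₑ ≤ ‖blockCurl χ q v x‖ₑ := by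
  have hcoord : ∀ k : Fin 3, blockCurl χ q v x k =
      ∫ y, (cross (v y) (∇ (fun y => kernel χ q (x - y)) y)) k := by
    intro k
    have hint : Integrable (fun y => cross (v y) (∇ (fun y => kernel χ q (x - y)) y)) volume := by
      refine Integrable.of_eval_piLp fun k => ?_
      fin_cases k
      · exact (integral_curlPart hχ q hv 1 2 x).1
      · exact (integral_curlPart hχ q hv 2 0 x).1
      · exact (integral_curlPart hχ q hv 0 1 x).1
    exact ((EuclideanSpace.proj (𝕜 := ℝ) k).integral_comp_comm hint).symm
  have hle : ∀ k : Fin 3, ‖((blockCurl χ q v x k : ℝ) : ℂ)‖ₑ ≤ ‖blockCurl χ q v x‖ₑ := by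
    intro k
    rw [enorm_le_iff_norm_le, Complex.norm_real]
    exact PiLp.norm_apply_le _ k
  have h01 : curlPart hχ q v 0 1 x = -((blockCurl χ q v x 2 : ℝ) : ℂ) := by
    rw [hcoord, ← neg_eq_iff_eq_neg, ← (integral_curlPart hχ q hv 0 1 x).2]
    rfl
  have h12 : curlPart hχ q v 1 2 x = -((blockCurl χ q v x 0 : ℝ) : ℂ) := by
    rw [hcoord, ← neg_eq_iff_eq_neg, ← (integral_curlPart hχ q hv 1 2 x).2]
    rfl
  have h20 : curlPart hχ q v 2 0 x = -((blockCurl χ q v x 1 : ℝ) : ℂ) := by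
    rw [hcoord, ← neg_eq_iff_eq_neg, ← (integral_curlPart hχ q hv 2 0 x).2]
    rfl
  have hswap : ∀ i j, curlPart hχ q v i j x = -curlPart hχ q v j i x := fun i j => by
    rw [curlPart, curlPart, neg_sub]
  have hself : ∀ i, ‖curlPart hχ q v i i x‖ₑ ≤ ‖blockCurl χ q v x‖ₑ := fun i => by
    simp [curlPart]
  fin_cases i <;> fin_cases j <;> simp only [Fin.zero_eta, Fin.mk_one, Fin.reduceFinMk]
  · exact hself 0
  · rw [h01, enorm_neg]; exact hle 2
  · rw [hswap, h20, neg_neg]; exact hle 1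
  · rw [hswap, h01, neg_neg]; exact hle 2
  · exact hself 1
  · rw [h12, enorm_neg]; exact hle 0
  · rw [h20, enorm_neg]; exact hle 1
  · rw [hswap, h12, neg_neg]; exact hle 0
  · exact hself 2

/-! ### The Biot-Savart law for the blocks -/

/-- The symbol `-λ_q⁻² ψ(λ_q⁻¹ ξ) / (4π² |λ_q⁻¹ ξ|²)` of a localized inverse Laplacian. -/
def invLap (χ : E3 → ℝ) (q : ℤ) (ξ : E3) : ℝ :=
  -((lam q)⁻¹ ^ 2 * ((χ ((lam 2)⁻¹ • (lam q)⁻¹ • ξ) - χ ((lam (-1))⁻¹ • (lam q)⁻¹ • ξ)) /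
    (4 * Real.pi ^ 2 * ‖(lam q)⁻¹ • ξ‖ ^ 2)))

/-- The numerator vanishes near the origin, where both cutoffs equal `1`, so the division by `‖ξ‖²`
does no harm. -/
theorem contDiff_invLap_zero (hχ : IsCutoff χ) :
    ContDiff ℝ ∞ (fun ξ : E3 => (χ ((lam 2)⁻¹ • ξ) - χ ((lam (-1))⁻¹ • ξ)) /
      (4 * Real.pi ^ 2 * ‖ξ‖ ^ 2)) := by
  rw [contDiff_iff_contDiffAt]
  intro ξ
  rcases eq_or_ne ξ 0 with rfl | h
  · refine (contDiffAt_const (c := (0 : ℝ))).congr_of_eventuallyEq ?_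
    have hnear : ∀ᶠ z : E3 in 𝓝 0, ‖z‖ < 3 / 8 :=
      continuous_norm.continuousAt.eventually_lt_const (by simp)
    filter_upwards [hnear] with z hz
    rw [hχ.eq_one, hχ.eq_one, sub_self, zero_div]
    · rw [norm_smul, norm_inv, Real.norm_of_nonneg (lam_pos _).le, inv_mul_le_iff₀ (lam_pos _)]
      norm_num [lam]; linarith
    · rw [norm_smul, norm_inv, Real.norm_of_nonneg (lam_pos _).le, inv_mul_le_iff₀ (lam_pos _)]
      norm_num [lam]; linarith
  · refine ContDiffAt.div ?_ ?_ ?_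
    · exact ((hχ.smooth.comp (contDiff_const_smul _)).sub
        (hχ.smooth.comp (contDiff_const_smul _))).contDiffAt
    · exact contDiffAt_const.mul (contDiff_norm_sq ℝ).contDiffAt
    · have := norm_pos_iff.2 h
      positivity

theorem contDiff_invLap (hχ : IsCutoff χ) (q : ℤ) : ContDiff ℝ ∞ (invLap χ q) :=
  (contDiff_const.mul ((contDiff_invLap_zero hχ).comp (contDiff_const_smul (lam q)⁻¹))).neg

theorem hasCompactSupport_invLap (hχ : IsCutoff χ) (q : ℤ) : HasCompactSupport (invLap χ q) := by
  have h : HasCompactSupport (fun ξ : E3 => (χ ((lam 2)⁻¹ • ξ) - χ ((lam (-1))⁻¹ • ξ)) /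
      (4 * Real.pi ^ 2 * ‖ξ‖ ^ 2)) := by
    simp only [div_eq_mul_inv]
    refine HasCompactSupport.mul_right (HasCompactSupport.sub ?_ ?_)
    · exact hasCompactSupport_dilate hχ.hasCompactSupport (inv_ne_zero (lam_pos _).ne')
    · exact hasCompactSupport_dilate hχ.hasCompactSupport (inv_ne_zero (lam_pos _).ne')
  exact ((hasCompactSupport_dilate h (inv_ne_zero (lam_pos q).ne')).mul_left
    (f := fun _ => (lam q)⁻¹ ^ 2)).neg

/-- The localized inverse Laplacian as a Schwartz symbol. -/
def invLapS (hχ : IsCutoff χ) (q : ℤ) : 𝓢(E3, ℂ) :=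
  bumpS (invLap χ q) (hasCompactSupport_invLap hχ q) (contDiff_invLap hχ q)

theorem derivS_invLapS_dilate (hχ : IsCutoff χ) (q : ℤ) (j : Fin 3) (ξ : E3) :
    derivS j (invLapS hχ q) ξ =
      ((lam q)⁻¹ : ℝ) * derivS j (invLapS hχ 0) ((lam q)⁻¹ • ξ) := by
  simp only [derivS_apply, invLapS, bumpS_apply, invLap, lam_zero, inv_one, one_smul, one_pow,
    one_mul, PiLp.smul_apply, smul_eq_mul]
  push_cast
  ring

/-- Where `φ_q` is nonzero, `η = λ_q⁻¹ ξ` satisfies `3/4 < ‖η‖ < 2`. There `χ(η/4) = 1` and `χ(2η) =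
0`, so `invLap` is exactly the inverse of the symbol `-4π²‖ξ‖²`. -/
theorem invLap_mul_symbol (hχ : IsCutoff χ) {q : ℤ} (hq : 0 ≤ q) (ξ : E3) :
    -(4 * Real.pi ^ 2 * ‖ξ‖ ^ 2) * invLap χ q ξ * symbol χ q ξ = symbol χ q ξ := by
  rcases eq_or_ne (symbol χ q ξ) 0 with h0 | h0
  · rw [h0, mul_zero]
  have hl := lam_pos q
  have h1 : 3 / 4 < ‖(lam q)⁻¹ • ξ‖ := by
    by_contra! h
    refine h0 (symbol_eq_zero hχ hq ?_)
    rw [norm_smul, norm_inv, Real.norm_of_nonneg hl.le, inv_mul_le_iff₀ hl] at h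
    linarith
  have h2 : ‖(lam q)⁻¹ • ξ‖ < 2 := by
    by_contra! h
    refine h0 ?_
    rw [symbol, if_pos hq, annulus, hχ.eq_zero, hχ.eq_zero, sub_zero]
    · linarith
    · rw [norm_smul, norm_inv, Real.norm_two]; linarith
  have h3 : χ ((lam 2)⁻¹ • (lam q)⁻¹ • ξ) = 1 := by
    apply hχ.eq_one
    rw [norm_smul, norm_inv, Real.norm_of_nonneg (lam_pos _).le, inv_mul_le_iff₀ (lam_pos _)]
    norm_num [lam] at h2 ⊢; linarith
  have h4 : χ ((lam (-1))⁻¹ • (lam q)⁻¹ • ξ) = 0 := by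
    apply hχ.eq_zero
    rw [norm_smul, norm_inv, Real.norm_of_nonneg (lam_pos _).le, le_inv_mul_iff₀ (lam_pos _)]
    norm_num [lam] at h1 ⊢; linarith
  have hξ : 0 < ‖ξ‖ := by
    rw [norm_pos_iff]; rintro rfl; simp at h1; linarith
  rw [invLap, h3, h4, norm_smul, norm_inv, Real.norm_of_nonneg hl.le]
  have := Real.pi_pos
  field_simp
  simp

theorem sum_sq_coord (ξ : E3) : ∑ j, (ξ j) ^ 2 = ‖ξ‖ ^ 2 := by
  rw [EuclideanSpace.norm_sq_eq]; simp

theorem symS_eq_sum (hχ : IsCutoff χ) {q : ℤ} (hq : 0 ≤ q) :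
    symS hχ q = ∑ j, smulS (derivS j (invLapS hχ q)) (derivS j (symS hχ q)) := by
  ext ξ
  have h1 : ∀ j : Fin 3, smulS (derivS j (invLapS hχ q)) (derivS j (symS hχ q)) ξ =
      ((-(4 * Real.pi ^ 2 * (ξ j) ^ 2) * invLap χ q ξ * symbol χ q ξ : ℝ) : ℂ) := by
    intro j
    simp only [smulS, SchwartzMap.pairing_apply_apply, ContinuousLinearMap.lsmul_apply, smul_eq_mul,
      derivS_apply, invLapS, bumpS_apply, symS_apply]
    push_cast
    linear_combination 4 * (Real.pi : ℂ) ^ 2 * (ξ j : ℂ) ^ 2 * (invLap χ q ξ : ℂ) *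
      (symbol χ q ξ : ℂ) * Complex.I_sq
  rw [sum_apply]
  simp_rw [h1]
  rw [← Complex.ofReal_sum, ← Finset.sum_mul, ← Finset.sum_mul, Finset.sum_neg_distrib,
    ← Finset.mul_sum, sum_sq_coord, invLap_mul_symbol hχ hq, symS_apply]

/-- Biot-Savart: `∑_j ∂_j Δ⁻¹(∂_j v_i - ∂_i v_j) = v_i - ∂_i Δ⁻¹ (∇·v)`, localized in frequency; the
last term vanishes. -/
theorem block_eq_sum_curlPart (hχ : IsCutoff χ) {q : ℤ} (hq : 0 ≤ q) {v : L2} (hv : IsDivFree v)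
    (i : Fin 3) (x : E3) : ((block χ q v x i : ℝ) : ℂ) =
      ∑ j, mult (derivS j (invLapS hχ q)) (curlPart hχ q v i j) x := by
  have hm := fun j => memLp_comp (Lp.memLp v) j
  have h1 : ∀ j, mult (derivS j (invLapS hχ q)) (curlPart hχ q v i j) x =
      mult (smulS (derivS j (invLapS hχ q)) (derivS j (symS hχ q))) (comp v i) x -
      mult (derivS j (smulS (invLapS hχ q) (derivS i (symS hχ q)))) (comp v j) x := by
    intro j
    rw [← smulS_derivS, ← mult_mult _ _ (hm i), ← mult_mult _ _ (hm j),
      ← mult_sub_right _ le_top (memLp_top_mult _ (hm i)) (memLp_top_mult _ (hm j))]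
    rfl
  simp_rw [h1]
  rw [Finset.sum_sub_distrib, hv.sum_mult_derivS hχ, sub_zero, ← mult_sum_left _ _ one_le_two (hm i),
    ← symS_eq_sum hχ hq, block_comp hχ q (Lp.memLp v)]

/-- The blocks of a divergence free field are controlled by those of its vorticity. -/
theorem exists_biotSavart (hχ : IsCutoff χ) : ∃ C : ℝ≥0∞, C ≠ ⊤ ∧ ∀ q : ℤ, 0 ≤ q → ∀ v : L2,
    IsDivFree v → weightedBlock χ 1 ⊤ q v ≤ C * eLpNorm (blockCurl χ q v) ⊤ volume := by
  set B : Fin 3 → ℝ≥0∞ := fun j => eLpNorm (ckernel (derivS j (invLapS hχ 0))) 1 volume with hB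
  refine ⟨∑ _i : Fin 3, ∑ j, B j, ?_, fun q hq v hv => ?_⟩
  · exact ENNReal.sum_ne_top.2 fun _ _ => ENNReal.sum_ne_top.2 fun _ _ =>
      (SchwartzMap.eLpNorm_lt_top _ _ _).ne
  have hl := lam_pos q
  set W := eLpNorm (blockCurl χ q v) ⊤ volume with hW
  have hcurl : ∀ i j, eLpNorm (curlPart hχ q v i j) ⊤ volume ≤ W := fun i j =>
    eLpNorm_mono_enorm (enorm_curlPart_le hχ q (Lp.memLp v) i j)
  have hmeas : ∀ i j, AEStronglyMeasurable (curlPart hχ q v i j) volume := fun i j =>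
    ((continuous_mult _ (memLp_comp (Lp.memLp v) i)).sub
      (continuous_mult _ (memLp_comp (Lp.memLp v) j))).aestronglyMeasurable
  -- `∂_j Δ⁻¹` has order `-1`, and dilating a symbol preserves the `L¹` norm of its kernel. The
  -- resulting `λ_q⁻¹` cancels the weight `λ_q`.
  have hk : ∀ j, eLpNorm (ckernel (derivS j (invLapS hχ q))) 1 volume =
      ENNReal.ofReal (lam q)⁻¹ * B j := by
    intro j
    rw [eLpNorm_ckernel_scale hl (derivS_invLapS_dilate hχ q j) 1 ⊤]
    simp only [threeDiv, ENNReal.inv_top, ENNReal.toReal_zero, mul_zero, Real.rpow_zero,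
      ENNReal.ofReal_one, mul_one, hB]
    rw [← ofReal_norm, Complex.norm_real, Real.norm_of_nonneg (by positivity)]
  have hcomp : ∀ i x, ‖((block χ q v x i : ℝ) : ℂ)‖ₑ ≤ ENNReal.ofReal (lam q)⁻¹ * (∑ j, B j) * W := by
    intro i x
    rw [block_eq_sum_curlPart hχ hq hv, Finset.mul_sum, Finset.sum_mul]
    refine (enorm_sum_le _ _).trans (Finset.sum_le_sum fun j _ => ?_)
    rw [← hk]
    exact (enorm_mult_le _ (hmeas i j) 1 ⊤ x).trans (by gcongr; exact hcurl i j)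
  have hpt : ∀ x, ‖block χ q v x‖ₑ ≤ ENNReal.ofReal (lam q)⁻¹ * (∑ _i : Fin 3, ∑ j, B j) * W := by
    intro x
    conv_lhs => rw [← sum_smul_basisVec (block χ q v x)]
    rw [Finset.mul_sum, Finset.sum_mul]
    refine (enorm_sum_le _ _).trans (Finset.sum_le_sum fun i _ => le_trans (le_of_eq ?_) (hcomp i x))
    rw [enorm_smul, enorm_eq_iff_norm_eq.2 (Complex.norm_real _)]
    simp [basisVec, enorm_eq_nnnorm]
  rw [weightedBlock, Real.rpow_one, eLpNorm_exponent_top]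
  calc _ ≤ ENNReal.ofReal (lam q) *
        (ENNReal.ofReal (lam q)⁻¹ * (∑ _i : Fin 3, ∑ j, B j) * W) := by
        gcongr
        exact eLpNormEssSup_le_of_ae_enorm_bound (ae_of_all _ hpt)
    _ = (ENNReal.ofReal (lam q) * ENNReal.ofReal (lam q)⁻¹) * ((∑ _i : Fin 3, ∑ j, B j) * W) := by
        ring
    _ = _ := by
        rw [← ENNReal.ofReal_mul hl.le, mul_inv_cancel₀ hl.ne', ENNReal.ofReal_one, one_mul]

/-! ### Time regularity of the blocks -/

/-- This transfers weak continuity in `L²` to continuity in time of the blocks at each point. -/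
theorem block_apply_eq_inner (hχ : IsCutoff χ) (q : ℤ) (x : E3) (i : Fin 3) :
    ∃ w : L2, ∀ v : L2, block χ q v x i = inner ℝ v w := by
  have hk : MemLp (fun y => kernel χ q (x - y)) 2 volume := by
    have h1 : kernel χ q = fun y => Complex.reCLM (ckernel (symS hχ q) y) := by
      ext1 y; rw [← ofReal_kernel hχ]; simp
    rw [h1]
    exact Complex.reCLM.comp_memLp' (((ckernel (symS hχ q)).memLp 2 volume).comp_measurePreserving
      (Measure.measurePreserving_sub_left volume x))
  have hw : MemLp (fun y => kernel χ q (x - y) • basisVec i) 2 volume :=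
    ((ContinuousLinearMap.id ℝ ℝ).smulRight (basisVec i)).comp_memLp' hk
  refine ⟨hw.toLp _, fun v => ?_⟩
  apply Complex.ofReal_injective
  rw [block_comp hχ q (Lp.memLp v), L2.inner_def, ← integral_complex_ofReal, mult,
    ← integral_sub_left_eq_self _ volume x]
  refine integral_congr_ae ?_
  filter_upwards [hw.coeFn_toLp] with y hy
  have h2 : ckernel (symS hχ q) (x - y) = (kernel χ q (x - y) : ℂ) := (ofReal_kernel hχ q _).symm
  rw [ckernel] at h2
  rw [hy, h2, inner_smul_right, EuclideanSpace.inner_single_right]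
  simp [comp]

theorem continuousOn_block (hχ : IsCutoff χ) (q : ℤ) {S : Set ℝ} {u : ℝ → L2}
    (hu : ∀ w : L2, ContinuousOn (fun t => inner ℝ (u t) w) S) (x : E3) :
    ContinuousOn (fun t => block χ q (u t) x) S := by
  have h : ∀ i : Fin 3, ContinuousOn (fun t => block χ q (u t) x i) S := by
    intro i
    obtain ⟨w, hw⟩ := block_apply_eq_inner hχ q x i
    simp_rw [hw]
    exact hu w
  have h2 := (PiLp.continuous_toLp 2 (fun _ : Fin 3 => ℝ)).comp_continuousOn (continuousOn_pi.2 h)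
  exact h2

/-- By Fatou the norm is lower semicontinuous in time, hence Borel. Clamping time to `[0,T]` by
`projIcc` gives a function on all of `ℝ`. -/
theorem aemeasurable_eLpNorm_block (hχ : IsCutoff χ) (q : ℤ) (r : ℝ≥0∞) {T : ℝ} (hT : 0 ≤ T)
    {u : ℝ → L2} (hu : ∀ w : L2, ContinuousOn (fun t => inner ℝ (u t) w) (Icc 0 T)) :
    AEMeasurable (fun t => eLpNorm (block χ q (u t)) r volume) (volume.restrict (Icc 0 T)) := by
  have hcont : ∀ x, Continuous fun t => block χ q (u (projIcc 0 T hT t)) x := fun x =>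
    (continuousOn_block hχ q hu x).comp_continuous (continuous_subtype_val.comp continuous_projIcc)
      fun t => (projIcc 0 T hT t).2
  have hlsc : LowerSemicontinuous fun t => eLpNorm (block χ q (u (projIcc 0 T hT t))) r volume := by
    rw [lowerSemicontinuous_iff_isClosed_preimage]
    intro a
    refine IsSeqClosed.isClosed fun τ t hτ hlim => ?_
    have h1 := Lp.eLpNorm_lim_le_liminf_eLpNorm (p := r) (μ := volume)
      (f := fun n => block χ q (u (projIcc 0 T hT (τ n))))
      (fun n => (continuous_block hχ q (Lp.memLp _)).aestronglyMeasurable)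
      (block χ q (u (projIcc 0 T hT t)))
      (ae_of_all _ fun x => ((hcont x).tendsto t).comp hlim)
    refine h1.trans ?_
    exact (liminf_le_liminf (Eventually.of_forall hτ)).trans_eq (by simp)
  refine hlsc.measurable.aemeasurable.congr ?_
  filter_upwards [ae_restrict_mem measurableSet_Icc] with t ht
  rw [projIcc_of_mem hT ht]

theorem aemeasurable_weightedBlock (hχ : IsCutoff χ) (σ : ℝ) (q : ℤ) (r : ℝ≥0∞) {T : ℝ} (hT : 0 ≤ T)
    {u : ℝ → L2} (hu : ∀ w : L2, ContinuousOn (fun t => inner ℝ (u t) w) (Icc 0 T)) :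
    AEMeasurable (fun t => weightedBlock χ σ r q (u t)) (volume.restrict (Icc 0 T)) :=
  (aemeasurable_eLpNorm_block hχ q r hT hu).const_mul _

/-! ### The dissipation index -/

theorem dissIndex_le {r : ℝ≥0∞} {m : ℝ} {v : E3 → E3} {N : ℕ} (h : ∀ p : ℕ, N < p →
    weightedBlock χ (-1 + threeDiv r) r p v < ENNReal.ofReal m) : dissIndex χ r m v ≤ N :=
  sInf_le ⟨N, h, rfl⟩

/-- If no block from `q` on reaches `m`, then `q - 1` is an admissible index. For `q = 0` the left
side always holds, whence the condition `1 ≤ q`. -/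
theorem le_dissIndex_iff {r : ℝ≥0∞} {m : ℝ} {v : E3 → E3} {q : ℕ} (hq : 1 ≤ q) :
    (q : ℕ∞) ≤ dissIndex χ r m v ↔
      ∃ p : ℕ, q ≤ p ∧ ENNReal.ofReal m ≤ weightedBlock χ (-1 + threeDiv r) r p v := by
  constructor
  · intro h
    by_contra! hp
    have h1 : dissIndex χ r m v ≤ ((q - 1 : ℕ) : ℕ∞) := dissIndex_le fun p hpq => hp p (by omega)
    have h2 : (q : ℕ∞) ≤ ((q - 1 : ℕ) : ℕ∞) := h.trans h1
    rw [Nat.cast_le] at h2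
    omega
  · rintro ⟨p, hqp, hp⟩
    refine le_sInf ?_
    rintro _ ⟨n, hn, rfl⟩
    simp only
    rw [Nat.cast_le]
    by_contra! hlt
    exact (hn p (by omega)).not_ge hp

theorem tendsto_lam_rpow {a : ℝ} (ha : a < 0) : Tendsto (fun p : ℕ => lam p ^ a) atTop (𝓝 0) := by
  have h1 : Tendsto (fun p : ℕ => lam p) atTop atTop := by
    simp only [lam, zpow_natCast]
    exact tendsto_pow_atTop_atTop_of_one_lt one_lt_two
  have := (tendsto_rpow_neg_atTop (neg_pos.2 ha)).comp h1
  simpa only [neg_neg, Function.comp_def] using this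

/-- Uniform smallness of the high frequencies of fields bounded in `H^s`, `s > 1/2`. -/
theorem exists_weightedBlock_lt (hχ : IsCutoff χ) {r : ℝ≥0∞} (hr : 2 ≤ r) {s : ℝ} (hs : 1 / 2 < s)
    {S : ℝ≥0∞} (hS : S ≠ ⊤) {m : ℝ} (hm : 0 < m) : ∃ N : ℕ, ∀ p : ℕ, N < p → ∀ v : L2,
      sobolevNorm s v ≤ S → weightedBlock χ (-1 + threeDiv r) r p v < ENNReal.ofReal m := by
  obtain ⟨C, hC, h⟩ := exists_weightedBlock_sobolev hχ hr (by linarith : 0 ≤ s)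
  have hlim : Tendsto (fun p : ℕ => C * ENNReal.ofReal (lam p ^ (1 / 2 - s)) * S) atTop (𝓝 0) := by
    have h1 := ENNReal.tendsto_ofReal (tendsto_lam_rpow (by linarith : 1 / 2 - s < 0))
    have h2 := ENNReal.Tendsto.mul_const (ENNReal.Tendsto.const_mul h1 (Or.inr hC)) (Or.inr hS)
    simpa using h2
  obtain ⟨N, hN⟩ := eventually_atTop.1 (hlim.eventually (gt_mem_nhds (ENNReal.ofReal_pos.2 hm)))
  refine ⟨N, fun p hp v hv => lt_of_le_of_lt ((h p (by positivity) v).trans ?_) (hN p hp.le)⟩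
  gcongr

/-- The continuous `H^s` norm attains its maximum on the compact interval, and the high blocks are
small uniformly on `H^s` balls. -/
theorem exists_dissIndex_le (hχ : IsCutoff χ) {r : ℝ≥0∞} (hr : 2 ≤ r) {m T : ℝ} (hm : 0 < m)
    {u b : ℝ → L2} (hreg : IsRegularOn u b (Ioo 0 T)) {a' b' : ℝ} (ha : 0 < a') (hb : b' < T) :
    ∃ N : ℕ, ∀ t ∈ Icc a' b', dissIndex χ r m (u t) ≤ N := by
  obtain ⟨s, hs, hfin, hcu, -⟩ := hreg
  have hsub : Icc a' b' ⊆ Ioo 0 T := fun t ht => ⟨ha.trans_le ht.1, ht.2.trans_lt hb⟩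
  rcases (Icc a' b').eq_empty_or_nonempty with he | hne
  · exact ⟨0, by simp [he]⟩
  obtain ⟨t₀, ht₀, hmax⟩ := isCompact_Icc.exists_isMaxOn hne (hcu.mono hsub)
  obtain ⟨N, hN⟩ := exists_weightedBlock_lt hχ hr hs (hfin t₀ (hsub ht₀)).1.ne hm
  exact ⟨N, fun t ht => dissIndex_le fun p hp => hN p hp (u t) (hmax ht)⟩

/-! ### The times `𝒯_q` -/

theorem Tq_le {T : ℝ} (hT : 0 ≤ T) (Q : ℝ → ℕ∞) (q : ℕ) : Tq T Q q ≤ T :=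
  Real.sSup_le (fun _ ht => ht.1.2.le) hT

theorem Tq_nonneg {T : ℝ} (hT : 0 ≤ T) (Q : ℝ → ℕ∞) (q : ℕ) : 0 ≤ Tq T Q q :=
  Real.sSup_nonneg fun t ht => by have := ht.1.1; linarith

theorem tendsto_Tq {T : ℝ} (hT : 0 < T) {Q : ℝ → ℕ∞}
    (hQ : ∀ b' < T, ∃ N : ℕ, ∀ t ∈ Icc (T / 2) b', Q t ≤ N) : Tendsto (Tq T Q) atTop (𝓝 T) := by
  rw [tendsto_order]
  refine ⟨fun a ha => ?_, fun a ha => Eventually.of_forall fun q => (Tq_le hT.le Q q).trans_lt ha⟩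
  obtain ⟨b', hb1, hb2⟩ := exists_between (max_lt ha (half_lt_self hT))
  obtain ⟨N, hN⟩ := hQ b' hb2
  filter_upwards [eventually_gt_atTop N] with q hq
  refine (le_max_left _ _).trans_lt (hb1.trans_le ?_)
  refine le_csSup ⟨T, fun _ ht => ht.1.2.le⟩ ⟨⟨(le_max_right _ _).trans_lt hb1, hb2⟩, fun τ hτ => ?_⟩
  exact (hN τ ⟨hτ.1.le, hτ.2.le⟩).trans_lt (by exact_mod_cast hq)

theorem lt_of_lt_Tq {T : ℝ} (hT : 0 < T) {Q : ℝ → ℕ∞} {q : ℕ} {t : ℝ} (h1 : T / 2 < t)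
    (h2 : t < Tq T Q q) : Q t < q := by
  -- The supremum of the empty set is `0` by convention, which is incompatible with `T / 2 < t <
  -- 𝒯_q`.
  have hne : {t | t ∈ Ioo (T / 2) T ∧ ∀ τ ∈ Ioo (T / 2) t, Q τ < (q : ℕ∞)}.Nonempty := by
    by_contra! h
    rw [Tq, h, Real.sSup_empty] at h2
    linarith
  obtain ⟨t', ht', hlt⟩ := exists_lt_of_lt_csSup hne h2
  exact ht'.2 t ⟨h1, hlt⟩

theorem lintegral_indicator_le_Tq {T : ℝ} (hT : 0 < T) {Q : ℝ → ℕ∞} {q : ℕ} {f g : ℝ → ℝ≥0∞}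
    (hfg : ∀ t ∈ Icc 0 T, (q : ℕ∞) ≤ Q t → f t ≤ g t) :
    ∫⁻ t in Icc (T / 2) T, {t | (q : ℕ∞) ≤ Q t}.indicator f t ≤ ∫⁻ t in Icc (Tq T Q q) T, g t := by
  rw [← lintegral_indicator measurableSet_Icc, ← lintegral_indicator measurableSet_Icc]
  refine lintegral_mono_ae ?_
  -- `𝒯_q` only constrains times after `T / 2`, so the endpoint is discarded as a null set.
  filter_upwards [compl_mem_ae_iff.2 (measure_singleton (T / 2))] with t ht
  by_cases ht1 : t ∈ Icc (T / 2) T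
  · by_cases ht2 : (q : ℕ∞) ≤ Q t
    · have h1 : T / 2 < t := lt_of_le_of_ne ht1.1 fun h => ht h.symm
      have h2 : t ∈ Icc (Tq T Q q) T := by
        refine ⟨?_, ht1.2⟩
        by_contra! h
        exact (lt_of_lt_Tq hT h1 h).not_ge ht2
      rw [indicator_of_mem ht1, indicator_of_mem h2, indicator_of_mem (show t ∈ {t | (q : ℕ∞) ≤ Q t} from ht2)]
      exact hfg t ⟨by linarith, ht1.2⟩ ht2
    · rw [indicator_of_mem ht1, indicator_of_notMem (show t ∉ {t | (q : ℕ∞) ≤ Q t} from ht2)]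
      exact zero_le
  · rw [indicator_of_notMem ht1]
    exact zero_le

theorem tendsto_lintegral_Tq {T : ℝ} (hT : 0 < T) {Q : ℝ → ℕ∞} (hlim : Tendsto (Tq T Q) atTop (𝓝 T))
    {g : ℝ → ℝ≥0∞} (hg : ∫⁻ t in Icc 0 T, g t < ⊤) :
    Tendsto (fun q => ∫⁻ t in Icc (Tq T Q q) T, g t) atTop (𝓝 0) := by
  have hvol : Tendsto ((volume.restrict (Icc 0 T)) ∘ fun q => Icc (Tq T Q q) T) atTop (𝓝 0) := by
    have h1 : Tendsto (fun q => ENNReal.ofReal (T - Tq T Q q)) atTop (𝓝 0) := by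
      have := ENNReal.tendsto_ofReal (hlim.const_sub T)
      simpa using this
    refine tendsto_of_tendsto_of_tendsto_of_le_of_le tendsto_const_nhds h1 (fun _ => zero_le)
      fun q => ?_
    exact (Measure.restrict_apply_le _ _).trans (by simp)
  refine (tendsto_setLIntegral_zero hg.ne hvol).congr fun q => ?_
  rw [Measure.restrict_restrict measurableSet_Icc, inter_eq_left.2]
  exact Icc_subset_Icc_left (Tq_nonneg hT.le Q q)

/-- Passing from `[T - ε, T]` to `[𝒯_q, T]`. -/
theorem limsup_lintegral_Tq_le {T : ℝ} {Q : ℝ → ℕ∞} (hlim : Tendsto (Tq T Q) atTop (𝓝 T))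
    {g : ℕ → ℝ → ℝ≥0∞} {L : ℝ≥0∞} (hL : Tendsto (fun ε : ℝ => limsup (fun q : ℕ =>
      ∫⁻ t in Icc (T - ε) T, g q t) atTop) (𝓝[>] 0) (𝓝 L)) :
    limsup (fun q : ℕ => ∫⁻ t in Icc (Tq T Q q) T, g q t) atTop ≤ L := by
  refine ge_of_tendsto hL ?_
  filter_upwards [self_mem_nhdsWithin] with ε hε
  refine limsup_le_limsup ?_
  filter_upwards [hlim.eventually (lt_mem_nhds (sub_lt_self T hε))] with q hq
  exact lintegral_mono_set (Icc_subset_Icc_left hq.le)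

/-! ### Conditions on the vorticity -/

theorem limsup_le_const_mul {f g : ℕ → ℝ≥0∞} {C D : ℝ≥0∞} (hC : C ≠ ⊤)
    (h : ∀ᶠ q in atTop, f q ≤ C * g q) (hg : limsup g atTop ≤ D) : limsup f atTop ≤ C * D := by
  refine (limsup_le_limsup h).trans ?_
  rw [ENNReal.limsup_const_mul_of_ne_top hC]
  gcongr

theorem criterion_of_vorticity {T c κ : ℝ} (hT : 0 < T) (hκ : 0 < κ)
    {Q : ℝ → ℕ∞} {u : ℝ → L2} {C : ℝ≥0∞} (hC : C ≠ ⊤) (hCκ : C * ENNReal.ofReal κ ≤ 1)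
    (hBS : ∀ q : ℤ, 0 ≤ q → ∀ t ∈ Icc 0 T,
      weightedBlock χ 1 ⊤ q (u t) ≤ C * eLpNorm (blockCurl χ q (u t)) ⊤ volume)
    (h : limsup (fun q : ℕ => ∫⁻ t in Icc (Tq T Q q) T,
      eLpNorm (blockCurl χ q (u t)) ⊤ volume) atTop ≤ ENNReal.ofReal (κ * c)) :
    Criterion χ c T Q u := by
  refine (limsup_le_const_mul hC (Eventually.of_forall fun q => ?_) h).trans ?_
  · rw [← lintegral_const_mul' _ _ hC]
    exact lintegral_indicator_le_Tq hT fun t ht _ => hBS q (by positivity) t ht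
  · rw [ENNReal.ofReal_mul hκ.le, ← mul_assoc]
    exact mul_le_of_le_one_left zero_le hCκ

theorem criterion_of_vorticity_sup {T c : ℝ} (hT : 0 < T)
    {Q : ℝ → ℕ∞} (hlim : Tendsto (Tq T Q) atTop (𝓝 T)) {u : ℝ → L2} {C : ℝ≥0∞} (hC : C ≠ ⊤)
    (hBS : ∀ q : ℤ, 0 ≤ q → ∀ t ∈ Icc 0 T,
      weightedBlock χ 1 ⊤ q (u t) ≤ C * eLpNorm (blockCurl χ q (u t)) ⊤ volume)
    (h : ∫⁻ t in Icc 0 T, (⨆ (q : ℤ) (_ : -1 ≤ q) (_ : (q.toNat : ℕ∞) ≤ Q t),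
      eLpNorm (blockCurl χ q (u t)) ⊤ volume) < ⊤) : Criterion χ c T Q u := by
  refine (limsup_le_const_mul hC (Eventually.of_forall fun q => ?_)
    (tendsto_lintegral_Tq hT hlim h).limsup_eq.le).trans (by simp)
  rw [← lintegral_const_mul' _ _ hC]
  refine lintegral_indicator_le_Tq hT fun t ht hq => (hBS q (by positivity) t ht).trans ?_
  gcongr
  exact le_iSup₂_of_le (q : ℤ) (by omega) (le_iSup_of_le (by simpa using hq) le_rfl)

/-! ### Besov type conditions -/

/-- The extra `2/l` in the exponent becomes the factor `λ_q²` for every `l`, the same factor that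
Bernstein produces. -/
theorem weightedBlock_rpow (σ : ℝ) (r : ℝ≥0∞) (q : ℤ) (v : E3 → E3) {l : ℝ} (hl : 0 < l) :
    weightedBlock χ (-1 + 2 / l + σ) r q v ^ l =
      ENNReal.ofReal (lam q ^ 2) * weightedBlock χ (-1 + σ) r q v ^ l := by
  have hq := lam_pos q
  rw [weightedBlock, weightedBlock, ENNReal.mul_rpow_of_nonneg _ _ hl.le,
    ENNReal.mul_rpow_of_nonneg _ _ hl.le, ← mul_assoc, ENNReal.ofReal_rpow_of_pos (by positivity),
    ENNReal.ofReal_rpow_of_pos (by positivity), ← ENNReal.ofReal_mul (by positivity),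
    ← Real.rpow_mul hq.le, ← Real.rpow_mul hq.le, ← Real.rpow_two, ← Real.rpow_add hq]
  congr 3
  field_simp
  ring

theorem exists_weightedBlock_top_le (hχ : IsCutoff χ) {r : ℝ≥0∞} (hr : 1 ≤ r) :
    ∃ C : ℝ≥0∞, C ≠ ⊤ ∧ ∀ q : ℤ, -1 ≤ q → ∀ v : L2, weightedBlock χ 1 ⊤ q v ≤
      C * (ENNReal.ofReal (lam q ^ 2) * weightedBlock χ (-1 + threeDiv r) r q v) := by
  obtain ⟨C, hC, h⟩ := exists_bernstein hχ hr
  refine ⟨C, hC, fun q hq v => ?_⟩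
  have hl := lam_pos q
  rw [weightedBlock, eLpNorm_exponent_top, Real.rpow_one, weightedBlock, ← mul_assoc (ENNReal.ofReal _),
    ← ENNReal.ofReal_mul (by positivity), ← Real.rpow_two, ← Real.rpow_add hl]
  calc _ ≤ ENNReal.ofReal (lam q) * (C * ENNReal.ofReal (lam q ^ threeDiv r) *
        eLpNorm (block χ q v) r volume) := by
        gcongr
        exact eLpNormEssSup_le_of_ae_enorm_bound (ae_of_all _ (h q hq v (Lp.memLp v)))
    _ = C * ((ENNReal.ofReal (lam q) * ENNReal.ofReal (lam q ^ threeDiv r)) *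
        eLpNorm (block χ q v) r volume) := by ring
    _ = _ := by
        rw [← ENNReal.ofReal_mul hl.le]
        congr 3
        rw [show (2 : ℝ) + (-1 + threeDiv r) = 1 + threeDiv r by ring, Real.rpow_add hl,
          Real.rpow_one]

/-- `x ≤ M + M^{1-l} x^l`. -/
theorem le_add_rpow {M : ℝ} (hM : 0 < M) {l : ℝ} (hl : 1 ≤ l) (x : ℝ≥0∞) :
    x ≤ ENNReal.ofReal M + ENNReal.ofReal (M ^ (1 - l)) * x ^ l := by
  rcases le_total x (ENNReal.ofReal M) with h | h
  · exact h.trans le_self_add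
  refine le_add_left ?_
  have hM' : ENNReal.ofReal M ≠ 0 := (ENNReal.ofReal_pos.2 hM).ne'
  have hx0 : x ≠ 0 := fun h0 => hM' (by simpa [h0] using h)
  rw [← ENNReal.ofReal_rpow_of_pos hM]
  rcases eq_or_ne x ⊤ with rfl | hx
  · rw [ENNReal.top_rpow_of_pos (by linarith), ENNReal.mul_top]
    exact (ENNReal.rpow_pos (ENNReal.ofReal_pos.2 hM) ENNReal.ofReal_ne_top).ne'
  calc x = x ^ (1 - l) * x ^ l := by
        rw [← ENNReal.rpow_add _ _ hx0 hx, sub_add_cancel, ENNReal.rpow_one]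
    _ ≤ _ := by
        gcongr 1
        rw [show 1 - l = -(l - 1) by ring, ENNReal.rpow_neg, ENNReal.rpow_neg]
        exact ENNReal.inv_le_inv.2 (ENNReal.rpow_le_rpow h (by linarith))

theorem tsum_quarter_le : ∑' k : ℕ, ENNReal.ofReal ((4 : ℝ)⁻¹ ^ k) ≤ 2 := by
  rw [← ENNReal.tsum_geometric_two]
  refine ENNReal.tsum_le_tsum fun k => ?_
  rw [ENNReal.ofReal_pow (by norm_num)]
  gcongr
  rw [ENNReal.ofReal_inv_of_pos (by norm_num)]
  gcongr
  norm_num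

/-- The integrals `∫ 1_{q ≤ Q} λ_q² F_q` are controlled by `∫ 1_{p ≤ Q} λ_p² F_p^l`, `p ≥ q`, if
`Q` is the largest index at which `F` exceeds the threshold `M`. -/
theorem lintegral_le_of_threshold {ρ : Measure ℝ} {F : ℕ → ℝ → ℝ≥0∞}
    (hF : ∀ p, AEMeasurable (F p) ρ) {M l : ℝ} (hM : 0 < M) (hl : 1 ≤ l) {Q : ℝ → ℕ∞} {q : ℕ}
    (hQ : ∀ p : ℕ, q ≤ p → ∀ t, (p : ℕ∞) ≤ Q t ↔ ∃ p' : ℕ, p ≤ p' ∧ ENNReal.ofReal M ≤ F p' t)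
    {δ : ℝ≥0∞} (hδ : ∀ p : ℕ, q ≤ p → ∫⁻ t, {t | (p : ℕ∞) ≤ Q t}.indicator
      (fun t => ENNReal.ofReal (lam p ^ 2) * F p t ^ l) t ∂ρ ≤ δ) :
    ∫⁻ t, {t | (q : ℕ∞) ≤ Q t}.indicator (fun t => ENNReal.ofReal (lam q ^ 2) * F q t) t ∂ρ ≤
      3 * (ENNReal.ofReal (M ^ (1 - l)) * δ) := by
  set E : ℕ → Set ℝ := fun p => {t | ENNReal.ofReal M ≤ F p t} with hE
  have hEm : ∀ p, NullMeasurableSet (E p) ρ := fun p => (hF p).nullMeasurableSet_preimage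
    measurableSet_Ici
  have hlp : ∀ p : ℕ, 0 < lam p := fun p => lam_pos p
  have hMl : 0 < M ^ l := Real.rpow_pos_of_pos hM l
  -- Chebyshev: on `E p` one has `p ≤ Q`, so `hδ` applies there with `F_p^l ≥ M^l`.
  have hEvol : ∀ p, q ≤ p → ρ (E p) ≤ δ * ENNReal.ofReal ((M ^ l)⁻¹ * (lam p ^ 2)⁻¹) := by
    intro p hp
    have h1 : ENNReal.ofReal (lam p ^ 2 * M ^ l) * ρ (E p) ≤ δ := by
      refine le_trans ?_ (hδ p hp)
      rw [← setLIntegral_const, ← lintegral_indicator₀ (hEm p)]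
      refine lintegral_mono fun t => ?_
      by_cases ht : t ∈ E p
      · have ht' : t ∈ {t | (p : ℕ∞) ≤ Q t} := (hQ p hp t).2 ⟨p, le_rfl, ht⟩
        rw [indicator_of_mem ht, indicator_of_mem ht', ENNReal.ofReal_mul (by positivity),
          ← ENNReal.ofReal_rpow_of_pos hM]
        gcongr
        exact ht
      · rw [indicator_of_notMem ht]; exact zero_le
    have h2 : (M ^ l)⁻¹ * (lam p ^ 2)⁻¹ = (lam p ^ 2 * M ^ l)⁻¹ := by rw [mul_inv, mul_comm]
    rw [h2, ENNReal.ofReal_inv_of_pos (by have := hlp p; positivity), ← div_eq_mul_inv,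
      ENNReal.le_div_iff_mul_le, mul_comm]
    · exact h1
    · left; exact (ENNReal.ofReal_pos.2 (by have := hlp p; positivity)).ne'
    · left; exact ENNReal.ofReal_ne_top
  have hset : {t | (q : ℕ∞) ≤ Q t} = ⋃ k : ℕ, E (q + k) := by
    ext t
    simp only [mem_ofPred_eq, mem_iUnion, hQ q le_rfl, hE]
    constructor
    · rintro ⟨p, hp, h⟩
      exact ⟨p - q, by rwa [Nat.add_sub_cancel' hp]⟩
    · rintro ⟨k, h⟩
      exact ⟨q + k, by omega, h⟩
  have hsetm : NullMeasurableSet {t | (q : ℕ∞) ≤ Q t} ρ := by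
    rw [hset]; exact NullMeasurableSet.iUnion fun k => hEm _
  have hratio : ∀ k : ℕ, lam q ^ 2 * M * ((M ^ l)⁻¹ * (lam ((q + k : ℕ) : ℤ) ^ 2)⁻¹) =
      M ^ (1 - l) * (4 : ℝ)⁻¹ ^ k := by
    intro k
    have h4 : lam (k : ℤ) ^ 2 = 4 ^ k := by
      rw [lam, zpow_natCast, ← pow_mul, mul_comm, pow_mul]; norm_num
    rw [Nat.cast_add, lam_add, mul_pow, h4, Real.rpow_sub hM, Real.rpow_one, inv_pow]
    have := hlp q
    field_simp
  -- Relative to `λ_q⁻²`, the bounds for `E (q + k)` decay like `4^{-k}`; the sum `4/3` is rounded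
  -- up to `2`.
  have hvol : ENNReal.ofReal (lam q ^ 2 * M) * ρ {t | (q : ℕ∞) ≤ Q t} ≤
      2 * (ENNReal.ofReal (M ^ (1 - l)) * δ) := by
    calc _ ≤ ENNReal.ofReal (lam q ^ 2 * M) * ∑' k : ℕ, δ *
          ENNReal.ofReal ((M ^ l)⁻¹ * (lam ((q + k : ℕ) : ℤ) ^ 2)⁻¹) := by
          gcongr
          rw [hset]
          exact (measure_iUnion_le _).trans (ENNReal.tsum_le_tsum fun k => hEvol _ (by omega))
      _ = ∑' k : ℕ, (ENNReal.ofReal (M ^ (1 - l)) * δ) * ENNReal.ofReal ((4 : ℝ)⁻¹ ^ k) := by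
          rw [← ENNReal.tsum_mul_left]
          refine tsum_congr fun k => ?_
          rw [mul_left_comm, ← ENNReal.ofReal_mul (by have := hlp q; positivity), hratio,
            ENNReal.ofReal_mul (by positivity)]
          ring
      _ ≤ _ := by
          rw [ENNReal.tsum_mul_left, mul_comm]
          gcongr
          exact tsum_quarter_le
  -- The constant part of `F_q ≤ M + M^{1-l}F_q^l` costs `2` by `hvol`, the power part costs `1` by
  -- `hδ`: in total `3`.
  have hpt : ∀ t, {t | (q : ℕ∞) ≤ Q t}.indicator (fun t => ENNReal.ofReal (lam q ^ 2) * F q t) t ≤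
      {t | (q : ℕ∞) ≤ Q t}.indicator (fun _ => ENNReal.ofReal (lam q ^ 2 * M)) t +
      ENNReal.ofReal (M ^ (1 - l)) * {t | (q : ℕ∞) ≤ Q t}.indicator
        (fun t => ENNReal.ofReal (lam q ^ 2) * F q t ^ l) t := by
    intro t
    by_cases ht : t ∈ {t | (q : ℕ∞) ≤ Q t}
    · rw [indicator_of_mem ht, indicator_of_mem ht, indicator_of_mem ht,
        ENNReal.ofReal_mul (by positivity), mul_left_comm, ← mul_add]
      gcongr
      exact le_add_rpow hM hl _
    · simp only [indicator_of_notMem ht, mul_zero, add_zero, le_refl]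
  refine (lintegral_mono hpt).trans ?_
  rw [lintegral_add_left' (aemeasurable_const.indicator₀ hsetm), lintegral_indicator₀ hsetm,
    setLIntegral_const, lintegral_const_mul' _ _ ENNReal.ofReal_ne_top]
  calc _ ≤ 2 * (ENNReal.ofReal (M ^ (1 - l)) * δ) + ENNReal.ofReal (M ^ (1 - l)) * δ := by
        gcongr
        exact hδ q le_rfl
    _ = _ := by ring

theorem criterion_of_besov (hχ : IsCutoff χ) {r : ℝ≥0∞} {T c κ m l : ℝ} (hT : 0 < T)
    (hc : 0 < c) (hκ : 0 < κ) (hκ1 : 2 * κ ≤ 1) (hm : 0 < m) (hl : 1 ≤ l) {u : ℝ → L2}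
    (hu : ∀ w : L2, ContinuousOn (fun t => inner ℝ (u t) w) (Icc 0 T))
    {Q : ℝ → ℕ∞} (hQ : ∀ t, Q t = dissIndex χ r (c * m) (u t))
    {C : ℝ≥0∞} (hC : C ≠ ⊤) (hCκ : C * ENNReal.ofReal (6 * κ) ≤ 1)
    (hB : ∀ q : ℤ, -1 ≤ q → ∀ v : L2, weightedBlock χ 1 ⊤ q v ≤
      C * (ENNReal.ofReal (lam q ^ 2) * weightedBlock χ (-1 + threeDiv r) r q v))
    (h : limsup (fun q : ℕ => ∫⁻ t in Icc (T / 2) T, {t | (q : ℕ∞) ≤ Q t}.indicator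
      (fun t => weightedBlock χ (-1 + 2 / l + threeDiv r) r q (u t) ^ l) t) atTop
      ≤ ENNReal.ofReal ((κ * c) ^ l * m ^ (l - 1))) :
    Criterion χ c T Q u := by
  -- The limsup bound is not strict. Doubling `κ` leaves room, so that the integrals are below `δ`
  -- for all large `q`.
  set δ := ENNReal.ofReal ((2 * κ * c) ^ l * m ^ (l - 1)) with hδ
  have hlt : ENNReal.ofReal ((κ * c) ^ l * m ^ (l - 1)) < δ := by
    rw [hδ, ENNReal.ofReal_lt_ofReal_iff (by positivity)]
    gcongr ?_ * _
    refine Real.rpow_lt_rpow (by positivity) ?_ (by linarith)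
    nlinarith [mul_pos hκ hc]
  have hev := eventually_lt_of_limsup_lt (h.trans_lt hlt)
  obtain ⟨q₀, hq₀⟩ := eventually_atTop.1 hev
  have hfin : 3 * (ENNReal.ofReal ((c * m) ^ (1 - l)) * δ) ≤ ENNReal.ofReal (6 * κ) * ENNReal.ofReal c := by
    rw [hδ, ← ENNReal.ofReal_mul (by positivity), ← ENNReal.ofReal_mul (by positivity),
      show (3 : ℝ≥0∞) = ENNReal.ofReal 3 by simp, ← ENNReal.ofReal_mul (by positivity)]
    apply ENNReal.ofReal_le_ofReal
    -- The powers of `m` cancel and one factor `c` survives. As `2κ ≤ 1`, `(2κ)^l ≤ 2κ`, so the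
    -- final constant `6κ` is free of `l`.
    have h1 : (c * m) ^ (1 - l) * ((2 * κ * c) ^ l * m ^ (l - 1)) = (2 * κ) ^ l * c := by
      rw [Real.mul_rpow hc.le hm.le, Real.mul_rpow (by positivity : (0 : ℝ) ≤ 2 * κ) hc.le]
      have h2 : c ^ (1 - l) * c ^ l = c := by
        rw [← Real.rpow_add hc, sub_add_cancel, Real.rpow_one]
      have h3 : m ^ (1 - l) * m ^ (l - 1) = 1 := by
        rw [← Real.rpow_add hm]; simp
      calc _ = (2 * κ) ^ l * (c ^ (1 - l) * c ^ l) * (m ^ (1 - l) * m ^ (l - 1)) := by ring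
        _ = _ := by rw [h2, h3, mul_one]
    rw [h1]
    have h4 : (2 * κ) ^ l ≤ 2 * κ := by
      simpa using Real.rpow_le_rpow_of_exponent_ge (by positivity) hκ1 hl
    nlinarith
  unfold Criterion
  refine limsup_le_of_le (h := eventually_atTop.2 ⟨max q₀ 1, fun q hq => ?_⟩)
  have hmeas : ∀ p : ℕ, AEMeasurable (fun t => weightedBlock χ (-1 + threeDiv r) r p (u t))
      (volume.restrict (Icc (T / 2) T)) := fun p =>
    (aemeasurable_weightedBlock hχ _ p r hT.le hu).mono_measure
      (Measure.restrict_mono (Icc_subset_Icc_left (by linarith)) le_rfl)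
  have key := lintegral_le_of_threshold hmeas (M := c * m) (by positivity) hl (Q := Q) (q := q)
    (δ := δ) (fun p hp t => by
      rw [hQ]
      exact le_dissIndex_iff ((le_max_right q₀ 1).trans (hq.trans hp))) (fun p hp => by
      have := (hq₀ p ((le_max_left q₀ 1).trans (hq.trans hp))).le
      simp_rw [weightedBlock_rpow (threeDiv r) r _ _ (by linarith : 0 < l)] at this
      exact this)
  calc _ ≤ ∫⁻ t in Icc (T / 2) T, C * {t | (q : ℕ∞) ≤ Q t}.indicator (fun t =>
        ENNReal.ofReal (lam q ^ 2) * weightedBlock χ (-1 + threeDiv r) r q (u t)) t := by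
        refine lintegral_mono fun t => ?_
        by_cases ht : t ∈ {t | (q : ℕ∞) ≤ Q t}
        · rw [indicator_of_mem ht, indicator_of_mem ht]
          exact hB q (by omega) (u t)
        · rw [indicator_of_notMem ht]; exact zero_le
    _ ≤ C * (ENNReal.ofReal (6 * κ) * ENNReal.ofReal c) := by
        rw [lintegral_const_mul' _ _ hC]
        gcongr
        exact key.trans hfin
    _ ≤ ENNReal.ofReal c := by
        rw [← mul_assoc]
        exact mul_le_of_le_one_left zero_le hCκ

theorem continuous_block_lowModes (hχ : IsCutoff χ) (p : ℤ) (Q : ℕ) {v : E3 → E3}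
    (hv : MemLp v 2 volume) : Continuous (block χ p (lowModes χ Q v)) := by
  rw [complexifyₗᵢ.isometry.isEmbedding.continuous_iff]
  exact (continuous_mult _ (memLp_complexify hv)).congr fun x =>
    (complexify_block_lowModes hχ p Q hv x).symm

/-- The blocks up to `Q` are controlled by the Besov norm of the low modes. -/
theorem weightedBlock_le_besovNorm_lowModes (hχ : IsCutoff χ) {r : ℝ≥0∞} (hr : 1 ≤ r) {σ : ℝ}
    (hσ : -1 ≤ σ) {q : ℕ} {Q : ℕ∞} (hq : (q : ℕ∞) ≤ Q) (v : L2) :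
    weightedBlock χ σ r q v ≤ 3 * besovNorm χ σ r (lowModes χ Q v) := by
  have hle : ∀ (p : ℤ), -1 ≤ p → ∀ w : E3 → E3, weightedBlock χ σ r p w ≤ besovNorm χ σ r w :=
    fun p hp w => le_iSup₂_of_le p hp le_rfl
  have h3 : ∀ x : ℝ≥0∞, x ≤ 3 * x := fun x => le_mul_of_one_le_left zero_le (by norm_num)
  induction Q using ENat.recTopCoe with
  | top =>
    rw [lowModes, if_pos rfl]
    exact (hle q (by omega) _).trans (h3 _)
  | coe Q =>
    have hq' : q ≤ Q := by exact_mod_cast hq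
    have hv := Lp.memLp v
    rcases hq'.lt_or_eq with hlt | rfl
    · refine le_trans (le_of_eq ?_) ((hle q (by omega) _).trans (h3 _))
      unfold weightedBlock
      congr 2
      ext1 x
      exact (block_lowModes_of_lt hχ (by exact_mod_cast hlt) hv x).symm
    · set B := besovNorm χ σ r (lowModes χ q v) with hB
      have hmeas : ∀ p, AEStronglyMeasurable (block χ p (lowModes χ q v)) volume := fun p =>
        (continuous_block_lowModes hχ p q hv).aestronglyMeasurable
      have hsplit : block χ q v = fun x =>
          block χ q (lowModes χ q v) x + block χ (q + 1) (lowModes χ q v) x :=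
        funext fun x => block_eq_add_block_lowModes hχ q hv x
      have hl := lam_pos q
      -- Moving the weight from index `q` to `q + 1` costs `2^{-σ} ≤ 2`, whence the constant `3 = 1
      -- + 2`.
      have hs : lam q ^ σ ≤ 2 * lam (q + 1) ^ σ := by
        rw [lam_add, lam_one, Real.mul_rpow hl.le two_pos.le]
        have : (2 : ℝ) ^ (-1 : ℝ) ≤ 2 ^ σ := Real.rpow_le_rpow_of_exponent_le one_le_two hσ
        rw [Real.rpow_neg_one] at this
        have h0 : 0 < lam q ^ σ := by positivity
        nlinarith
      calc weightedBlock χ σ r q v ≤ weightedBlock χ σ r q (lowModes χ q v) +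
            ENNReal.ofReal (lam q ^ σ) * eLpNorm (block χ (q + 1) (lowModes χ q v)) r volume := by
            unfold weightedBlock
            rw [← mul_add, hsplit]
            gcongr
            exact eLpNorm_add_le (hmeas _) (hmeas _) hr
        _ ≤ weightedBlock χ σ r q (lowModes χ q v) +
            2 * weightedBlock χ σ r (q + 1) (lowModes χ q v) := by
            refine add_le_add le_rfl ?_
            unfold weightedBlock
            rw [← mul_assoc]
            gcongr
            refine (ENNReal.ofReal_le_ofReal hs).trans (le_of_eq ?_)
            rw [ENNReal.ofReal_mul two_pos.le, ENNReal.ofReal_ofNat]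
        _ ≤ B + 2 * B := by
            gcongr
            · exact hle _ (by omega) _
            · exact hle _ (by omega) _
        _ = 3 * B := by ring

theorem exists_small_const {A B : ℝ≥0∞} (hA : A ≠ ⊤) (hB : B ≠ ⊤) : ∃ κ : ℝ, 0 < κ ∧ 2 * κ ≤ 1 ∧
    A * ENNReal.ofReal κ ≤ 1 ∧ B * ENNReal.ofReal (6 * κ) ≤ 1 := by
  lift A to NNReal using hA
  lift B to NNReal using hB
  have hD : (0 : ℝ) < 6 * (A + B + 1) := by positivity
  have key : ∀ (x : NNReal) (y : ℝ), (x : ℝ) * y ≤ 1 → (x : ℝ≥0∞) * ENNReal.ofReal y ≤ 1 := by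
    intro x y h
    rw [← ENNReal.ofReal_coe_nnreal, ← ENNReal.ofReal_mul x.coe_nonneg]
    exact ENNReal.ofReal_le_one.2 h
  have hA0 := A.coe_nonneg
  have hB0 := B.coe_nonneg
  refine ⟨(6 * (A + B + 1))⁻¹, inv_pos.2 hD, ?_, key _ _ ?_, key _ _ ?_⟩
  · rw [← div_eq_mul_inv, div_le_one hD]; linarith
  · rw [← div_eq_mul_inv, div_le_one hD]; linarith
  · rw [← mul_assoc, ← div_eq_mul_inv, div_le_one hD]; linarith

/-! ### Small jumps -/

theorem weightedBlock_triangle (hχ : IsCutoff χ) (σ : ℝ) {r : ℝ≥0∞} (hr : 1 ≤ r) (q : ℤ)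
    (v w z : L2) : weightedBlock χ σ r q v ≤ weightedBlock χ σ r q (⇑(v - w)) +
      weightedBlock χ σ r q (⇑(z - w)) + weightedBlock χ σ r q z := by
  have hm : ∀ v : L2, AEStronglyMeasurable (block χ q v) volume := fun v =>
    (continuous_block hχ q (Lp.memLp v)).aestronglyMeasurable
  have h1 : block χ q v = (block χ q (⇑(v - w)) - block χ q (⇑(z - w))) + block χ q z := by
    ext1 x
    simp only [Pi.add_apply, Pi.sub_apply, block_sub hχ]
    abel
  unfold weightedBlock
  rw [← mul_add, ← mul_add]
  gcongr
  rw [h1]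
  refine (eLpNorm_add_le ((hm _).sub (hm _)) (hm _) hr).trans ?_
  gcongr
  exact eLpNorm_sub_le (hm _) (hm _) hr

/-- Split `u(t) = (u(t) - u(T)) - (u(t₁) - u(T)) + u(t₁)`. The two jumps are small at all
frequencies, `u(t₁)` at high ones, and the sum of the three stays below the threshold. Hence `Q` is
bounded on `[T/2,T)`. -/
theorem criterion_of_small_jump (hχ : IsCutoff χ) {r : ℝ≥0∞} (hr : 2 ≤ r) {T c κ m : ℝ} (hT : 0 < T)
    (hc : 0 < c) (hκ : 0 < κ) (hκ1 : 2 * κ ≤ 1) (hm : 0 < m) {u b : ℝ → L2}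
    (hreg : IsRegularOn u b (Ioo 0 T))
    {Q : ℝ → ℕ∞} (hQ : ∀ t, Q t = dissIndex χ r (c * m) (u t))
    (h : limsup (fun t => besovNorm χ (-1 + threeDiv r) r (⇑(u t - u T))) (𝓝[<] T)
      ≤ ENNReal.ofReal (κ * c * m / 2)) : Criterion χ c T Q u := by
  have hcm : 0 < c * m := mul_pos hc hm
  -- `κ ≤ 1/2` gives `κ/2 ≤ 1/4 < 1/3`; each of the three pieces may use a third of the threshold.
  have hlt : ENNReal.ofReal (κ * c * m / 2) < ENNReal.ofReal (c * m / 3) := by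
    rw [ENNReal.ofReal_lt_ofReal_iff (by positivity)]
    nlinarith
  have hev := eventually_lt_of_limsup_lt (h.trans_lt hlt)
  obtain ⟨a, haT, ha⟩ := (mem_nhdsLT_iff_exists_Ioo_subset' (sub_one_lt T)).1 hev
  obtain ⟨t₁, ht₁, ht₁T⟩ := exists_between (max_lt (show a < T from haT) (half_lt_self hT))
  have hat : a < t₁ := (le_max_left _ _).trans_lt ht₁
  have ht2 : T / 2 < t₁ := (le_max_right _ _).trans_lt ht₁
  obtain ⟨N₁, hN₁⟩ := exists_dissIndex_le hχ hr hcm hreg (half_pos hT) ht₁T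
  have hreg' := hreg
  obtain ⟨s, hs, hfin, -, -⟩ := hreg'
  obtain ⟨N₂, hN₂⟩ := exists_weightedBlock_lt hχ hr hs (hfin t₁ ⟨by linarith, ht₁T⟩).1.ne
    (show 0 < c * m / 3 by positivity)
  have hbd : ∀ t ∈ Ico (T / 2) T, Q t ≤ (max N₁ N₂ : ℕ) := by
    intro t ht
    rw [hQ]
    rcases le_or_gt t t₁ with htt | htt
    · exact (hN₁ t ⟨ht.1, htt⟩).trans (by exact_mod_cast le_max_left _ _)
    · refine (dissIndex_le fun p hp => ?_).trans (show (N₂ : ℕ∞) ≤ _ by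
        exact_mod_cast le_max_right _ _)
      have hj : ∀ t ∈ Ioo a T, weightedBlock χ (-1 + threeDiv r) r p (⇑(u t - u T)) <
          ENNReal.ofReal (c * m / 3) := fun t ht =>
        lt_of_le_of_lt (le_iSup₂_of_le (p : ℤ) (by omega) le_rfl) (ha ht)
      have h1 := hj t ⟨hat.trans htt, ht.2⟩
      have h2 := hj t₁ ⟨hat, ht₁T⟩
      have h3 := hN₂ p hp (u t₁) le_rfl
      refine (weightedBlock_triangle hχ _ (one_le_two.trans hr) p (u t) (u T) (u t₁)).trans_lt ?_
      refine (ENNReal.add_lt_add (ENNReal.add_lt_add h1 h2) h3).trans_eq ?_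
      rw [← ENNReal.ofReal_add (by positivity) (by positivity),
        ← ENNReal.ofReal_add (by positivity) (by positivity)]
      congr 1
      ring
  unfold Criterion
  refine limsup_le_of_le (h := eventually_atTop.2 ⟨max N₁ N₂ + 1, fun q hq => ?_⟩)
  refine le_trans (le_of_eq ?_) zero_le
  rw [← lintegral_indicator measurableSet_Icc]
  refine (lintegral_congr_ae ?_).trans lintegral_zero
  -- The bound on `Q` does not cover `t = T`, which is a null set.
  filter_upwards [compl_mem_ae_iff.2 (measure_singleton T)] with t ht
  by_cases ht1 : t ∈ Icc (T / 2) T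
  · rw [indicator_of_mem ht1, indicator_of_notMem]
    intro h1
    have h2 := (show (q : ℕ∞) ≤ Q t from h1).trans (hbd t ⟨ht1.1, lt_of_le_of_ne ht1.2 ht⟩)
    rw [Nat.cast_le] at h2
    omega
  · rw [indicator_of_notMem ht1]

end MHD

end

/-! ### The theorem -/

/-- Sufficient conditions for the regularity criterion; `κ` depends only on `r` (and the cutoff). -/
theorem theorem2 (χ : MHD.E3 → ℝ) (hχ : MHD.IsCutoff χ) (r : ℝ≥0∞) (hr : 2 ≤ r) :
    ∃ κ : ℝ, 0 < κ ∧
      ∀ (c ν μ T : ℝ), 0 < c → 0 < ν → 0 < μ → 0 < T →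
      ∀ (u b : ℝ → MHD.L2), MHD.IsWeakSolution ν μ T u b → MHD.IsRegularOn u b (Ioo 0 T) →
      (r < 6 ∨ ∀ t ∈ Icc 0 T, b t = 0) →
      ∀ (Q : ℝ → ℕ∞), (∀ t, Q t = MHD.dissIndex χ r (c * min ν μ) (u t)) →
        Tendsto (MHD.Tq T Q) atTop (𝓝 T) ∧
        (( -- vorticity blocks on `[𝒯_q, T]`
          limsup (fun q : ℕ => ∫⁻ t in Icc (MHD.Tq T Q q) T,
              eLpNorm (MHD.blockCurl χ q (u t)) ⊤ volume) atTop ≤ ENNReal.ofReal (κ * c)) ∨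
         ( -- vorticity blocks on `[T - ε, T]`
          ∃ L : ℝ≥0∞, Tendsto (fun ε : ℝ => limsup (fun q : ℕ => ∫⁻ t in Icc (T - ε) T,
              eLpNorm (MHD.blockCurl χ q (u t)) ⊤ volume) atTop) (𝓝[>] 0) (𝓝 L) ∧
            L ≤ ENNReal.ofReal (κ * c)) ∨
         ( -- vorticity blocks below `Q`; for `q ≥ -1`, `q.toNat ≤ Q t` means `q ≤ Q t`
          ∫⁻ t in Icc 0 T, (⨆ (q : ℤ) (_ : -1 ≤ q) (_ : (q.toNat : ℕ∞) ≤ Q t),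
              eLpNorm (MHD.blockCurl χ q (u t)) ⊤ volume) < ⊤) ∨
         ( -- Besov type condition below `Q`
          ∃ l : ℝ, 1 ≤ l ∧
            limsup (fun q : ℕ => ∫⁻ t in Icc 0 T, {t | (q : ℕ∞) ≤ Q t}.indicator
              (fun t => MHD.weightedBlock χ (-1 + 2 / l + MHD.threeDiv r) r q (u t) ^ l) t) atTop
            ≤ ENNReal.ofReal ((κ * c) ^ l * (min ν μ) ^ (l - 1))) ∨
         ( -- Besov type condition on `[𝒯_q, T]`
          ∃ l : ℝ, 1 ≤ l ∧
            limsup (fun q : ℕ => ∫⁻ t in Icc (MHD.Tq T Q q) T,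
              MHD.weightedBlock χ (-1 + 2 / l + MHD.threeDiv r) r q (u t) ^ l) atTop
            ≤ ENNReal.ofReal ((κ * c) ^ l * (min ν μ) ^ (l - 1))) ∨
         ( -- Besov type condition on `[T - ε, T]`
          ∃ l : ℝ, 1 ≤ l ∧ ∃ L : ℝ≥0∞,
            Tendsto (fun ε : ℝ => limsup (fun q : ℕ => ∫⁻ t in Icc (T - ε) T,
              MHD.weightedBlock χ (-1 + 2 / l + MHD.threeDiv r) r q (u t) ^ l) atTop)
              (𝓝[>] 0) (𝓝 L) ∧
            L ≤ ENNReal.ofReal ((κ * c) ^ l * (min ν μ) ^ (l - 1))) ∨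
         ( -- Besov norm of the low modes
          ∃ l : ℝ, 1 ≤ l ∧
            ∫⁻ t in Icc 0 T, MHD.besovNorm χ (-1 + 2 / l + MHD.threeDiv r) r
              (MHD.lowModes χ (Q t) (u t)) ^ l < ⊤) ∨
         ( -- small jump at `T` in the critical Besov space
          limsup (fun t => MHD.besovNorm χ (-1 + MHD.threeDiv r) r (⇑(u t - u T))) (𝓝[<] T)
            ≤ ENNReal.ofReal (κ * c * min ν μ / 2)) →
          MHD.Criterion χ c T Q u) := by
  obtain ⟨CV, hCV, hBS⟩ := MHD.exists_biotSavart hχ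
  obtain ⟨CB, hCB, hB⟩ := MHD.exists_weightedBlock_top_le hχ (one_le_two.trans hr)
  -- `κ` absorbs the Biot-Savart constant directly, and the Bernstein constant with the factor `6 =
  -- 3 · 2` from the threshold lemma and the doubling.
  obtain ⟨κ, hκ, hκ1, hCVκ, hCBκ⟩ := MHD.exists_small_const hCV hCB
  refine ⟨κ, hκ, fun c ν μ T hc hν hμ hT u b hsol hreg _ Q hQ => ?_⟩
  have hm : 0 < min ν μ := lt_min hν hμ
  have hlim : Tendsto (MHD.Tq T Q) atTop (𝓝 T) := MHD.tendsto_Tq hT fun b' hb' => by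
    simp_rw [hQ]
    exact MHD.exists_dissIndex_le hχ hr (mul_pos hc hm) hreg (half_pos hT) hb'
  have hBS' : ∀ q : ℤ, 0 ≤ q → ∀ t ∈ Icc 0 T, MHD.weightedBlock χ 1 ⊤ q (u t) ≤
      CV * eLpNorm (MHD.blockCurl χ q (u t)) ⊤ volume := fun q hq t ht =>
    hBS q hq (u t) (hsol.velocity.divFree t ht)
  have hbesov : ∀ l : ℝ, 1 ≤ l → limsup (fun q : ℕ => ∫⁻ t in Icc (T / 2) T,
      {t | (q : ℕ∞) ≤ Q t}.indicator
        (fun t => MHD.weightedBlock χ (-1 + 2 / l + MHD.threeDiv r) r q (u t) ^ l) t) atTop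
      ≤ ENNReal.ofReal ((κ * c) ^ l * (min ν μ) ^ (l - 1)) → MHD.Criterion χ c T Q u :=
    fun l hl h => MHD.criterion_of_besov hχ hT hc hκ hκ1 hm hl hsol.velocity.weaklyContinuous hQ hCB
      hCBκ hB h
  have hbesovTq : ∀ l : ℝ, 1 ≤ l → limsup (fun q : ℕ => ∫⁻ t in Icc (MHD.Tq T Q q) T,
      MHD.weightedBlock χ (-1 + 2 / l + MHD.threeDiv r) r q (u t) ^ l) atTop
      ≤ ENNReal.ofReal ((κ * c) ^ l * (min ν μ) ^ (l - 1)) → MHD.Criterion χ c T Q u :=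
    fun l hl h => hbesov l hl <| (limsup_le_limsup (Eventually.of_forall fun q =>
      MHD.lintegral_indicator_le_Tq hT fun _ _ _ => le_rfl)).trans h
  refine ⟨hlim, ?_⟩
  rintro (h | ⟨L, hL, hLc⟩ | h | ⟨l, hl, h⟩ | ⟨l, hl, h⟩ | ⟨l, hl, L, hL, hLc⟩ | ⟨l, hl, h⟩ | h)
  · exact MHD.criterion_of_vorticity hT hκ hCV hCVκ hBS' h
  · exact MHD.criterion_of_vorticity hT hκ hCV hCVκ hBS' ((MHD.limsup_lintegral_Tq_le hlim hL).trans hLc)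
  · exact MHD.criterion_of_vorticity_sup hT hlim hCV hBS' h
  · exact hbesov l hl <| (limsup_le_limsup (Eventually.of_forall fun q =>
      lintegral_mono_set (Icc_subset_Icc_left (half_pos hT).le))).trans h
  · exact hbesovTq l hl h
  · exact hbesovTq l hl ((MHD.limsup_lintegral_Tq_le hlim hL).trans hLc)
  · refine hbesov l hl ?_
    -- This is the range in which the blocks up to `Q` are bounded by three times the norm of the
    -- low modes. Their integral over `[𝒯_q,T]` tends to zero, so the limsup in question is `0`.
    have hσ : -1 ≤ -1 + 2 / l + MHD.threeDiv r := by
      have : 0 ≤ MHD.threeDiv r := mul_nonneg (by norm_num) ENNReal.toReal_nonneg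
      have : 0 ≤ 2 / l := by positivity
      linarith
    have h3 : (3 : ℝ≥0∞) ^ l ≠ ⊤ := ENNReal.rpow_ne_top_of_nonneg (by linarith) (by simp)
    refine (MHD.limsup_le_const_mul h3 (Eventually.of_forall fun q => ?_)
      (MHD.tendsto_lintegral_Tq hT hlim h).limsup_eq.le).trans (by simp)
    rw [← lintegral_const_mul' _ _ h3]
    refine MHD.lintegral_indicator_le_Tq hT fun t _ hq => ?_
    rw [← ENNReal.mul_rpow_of_nonneg _ _ (by linarith)]
    exact ENNReal.rpow_le_rpow (MHD.weightedBlock_le_besovNorm_lowModes hχ (one_le_two.trans hr) hσ hq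
      (u t)) (by linarith)
  · exact MHD.criterion_of_small_jump hχ hr hT hc hκ hκ1 hm hreg hQ h
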